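/- Let $\Delta\subset\mathbb R^2$ be a strictly convex lattice polygon with the origin in its interior, with vertices $v_0,\dots,v_{r-1}\in N=\mathbb Z^2$ listed counterclockwise (indices mod $r$). Let $X$ be the complete toric Fano Deligne–Mumford stack over $\mathbb C$ of dimension two whose stacky fan has rays generated by the (not necessarily primitive) $v_i$ and maximal cones spanned by $v_i,v_{i+1}$. Its Euler characteristic is $\chi(X)=\sum_i\det(v_i,v_{i+1})$, the sum of the orders of the isotropy groups of the torus-fixed points (equivalently, the integral volume of $\Delta$). Let $\mathcal L_1,\dots,\mathcal L_n$ be a strong exceptional collection of line bundles on $X$, that is, $\mathrm{Hom}(\mathcal L_j,\mathcal L_j)=\mathbb C$, $\mathrm{Ext}^p(\mathcal L_j,\mathcal L_k)=0$ for all $j,k$ and $p\neq 0$, and $\mathrm{Hom}(\mathcal L_j,\mathcal L_k)=0$ for $j>k$ (for instance a full one; fullness is not needed). Let $A=\mathrm{End}(\bigoplus_j\mathcal L_j)$ be the associated quiver algebra and $S_1,\dots,S_n$ its simple right modules, $S_i$ being one-dimensional at the vertex $i$ and zero at the others. Let $R=\mathrm{Ext}_A^\bullet(\bigoplus_i S_i,\bigoplus_i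 S_i)$ be the Yoneda algebra with its $A_\infty$-structure $(m_k)$, that is, any minimal $A_\infty$-structure, $\mathbb C^n$-multilinear with respect to the vertices, admitting a $\mathbb C^n$-multilinear $A_\infty$-quasi-isomorphism, which lifts the identity in cohomology, to the differential graded algebra $\mathrm{Hom}_A^\bullet(\bigoplus_i P_i,\bigoplus_i P_i)$, where $P_i\to S_i$ are any projective resolutions. Let $L$ be the associated $L_\infty$-algebra: $L=R$ as a graded space, and $\mu_k(x_1,\dots,x_k)=\sum_{\sigma}\pm m_k(x_{\sigma(1)},\dots,x_{\sigma(k)})$ is the graded antisymmetrization of $m_k$. Let $L_\omega=L\oplus L^*[-3]$ be the cyclic completion of $L$. Its products $\bar\mu_k$ equal $\mu_k$ if all inputs are in $L$, vanish if more than one input is in $L^*$, and if exactly the $i$-th input $a_i^*$ is in $L^*$, then $\bar\mu_k(a_1,\dots,a_i^*,\dots,a_k)\in L^*$ is given on homogeneous elements by $$\kappa(\bar\mu_k(a_1,\dots,a_i^*,\dots,a_k),b)=(-1)^{\epsilon}\,\kappa(\mu_k(a_{i+1},\dots,a_k,b,a_1,\dots,a_{i-1}),a_i^*)\qquad(b\in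 L),$$ where $\kappa$ is the natural pairing of $L$ with $L^*$ and $\epsilon$ is the sign of the rotation, in any convention depending only on $k$, $i$ and the parities of the degrees. Then $\mu_k=0$ for all $k>\chi(X)$, and likewise $\bar\mu_k=0$ on $L_\omega$ for all $k>\chi(X)$. -/

import Mathlib

open CategoryTheory CochainComplex.HomComplex

noncomputable section

/-! ## Two-dimensional toric Fano stacks and the cohomology of their line bundles -/

/-- The determinant of two vectors of the lattice `N = ℤ²`. -/
def latticeDet (a b : ℤ × ℤ) : ℤ := a.1 * b.2 - a.2 * b.1

/-- The natural pairing `⟨u, a⟩` of the character lattice `M = ℤ²` with `N = ℤ²`. -/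
def latticePairing (u a : ℤ × ℤ) : ℤ := u.1 * a.1 + u.2 * a.2

/-- The combinatorial datum of a complete toric Fano stack `X` of dimension two: a convex lattice
polygon whose vertices `v 0, …, v (r - 1)`, listed counterclockwise (indices modulo `r`), go around
the origin, a distinguished interior lattice point. The rays of the stacky fan of `X` are spanned by
the `v i` (not necessarily primitive), the maximal cones by the pairs `v i, v (i + 1)`. -/
structure ToricFanoSurface (r : ℕ) [NeZero r] where
  /-- The vertices. -/
  v : Fin r → ℤ × ℤ
  /-- The origin lies strictly to the left of every oriented edge. -/
  origin_interior : ∀ i, 0 < latticeDet (v i) (v (i + 1))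
  /-- All other vertices lie strictly to the left of every oriented edge. -/
  convex : ∀ i j, j ≠ i → j ≠ i + 1 → 0 < latticeDet (v (i + 1) - v i) (v j - v i)

namespace ToricFanoSurface

/-- Torus-invariant divisors `∑ d i • E i`. Every line bundle on `X` is isomorphic to `𝒪(d)` for
such a `d`. -/
abbrev Divisor (r : ℕ) := Fin r → ℤ

/-- The group algebra `ℂ[M]` of rational functions spanned by the characters of the torus. -/
abbrev CharRing := AddMonoidAlgebra ℂ (ℤ × ℤ)

variable {r : ℕ} [NeZero r] (X : ToricFanoSurface r)

/-- The Euler characteristic of the stack `X` (the Euler characteristic of its inertia stack):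
the sum over the torus-fixed points, i.e. over the maximal cones, of the order
`|N / (ℤ v i + ℤ v (i + 1))| = det (v i, v (i + 1))` of the isotropy group. It is the integral
volume (twice the area) of the polygon. -/
def eulerChar : ℤ := ∑ i, latticeDet (X.v i) (X.v (i + 1))

/-- The maximal cones. -/
def maxCone (i : Fin r) : Finset (Fin r) := {i, i + 1}

/-- The sections of `𝒪(d)` over the open substack given by the rays in `τ`: they are spanned by the
characters `u` with `⟨u, v i⟩ + d i ≥ 0` for `i ∈ τ`. -/
def sectionsOn (d : Divisor r) (τ : Finset (Fin r)) : Submodule ℂ CharRing where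
  carrier := {f | ∀ u, f.coeff u ≠ 0 → ∀ i ∈ τ, 0 ≤ latticePairing u (X.v i) + d i}
  zero_mem' := by
    intro u hu
    simp at hu
  add_mem' := by
    intro f g hf hg u hu
    by_cases h : f.coeff u = 0
    · refine hg u ?_
      intro h'
      simp [h, h'] at hu
    · exact hf u h
  smul_mem' := by
    intro c f hf u hu
    refine hf u ?_
    intro h
    simp [h] at hu

/-- The rays common to the maximal cones `α 0, …, α p`. -/
def commonRays {p : ℕ} (α : Fin (p + 1) → Fin r) : Finset (Fin r) :=
  Finset.univ.filter fun i => ∀ q, i ∈ maxCone (α q)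

/-- Čech `p`-cochains of `𝒪(d)` for the covering of `X` by the open substacks of the maximal cones
(these substacks and their intersections are quotients of affine varieties by finite groups, so the
Čech complex computes the cohomology of line bundles). -/
def cechCochains (d : Divisor r) (p : ℕ) : Submodule ℂ ((Fin (p + 1) → Fin r) → CharRing) :=
  Submodule.pi Set.univ fun α => X.sectionsOn d (commonRays α)

/-- The Čech differential. -/
def cechDiff (r p : ℕ) : ((Fin (p + 1) → Fin r) → CharRing) →ₗ[ℂ]
    ((Fin (p + 2) → Fin r) → CharRing) :=
  LinearMap.pi fun α => ∑ q : Fin (p + 2), ((-1 : ℤ) ^ (q : ℕ)) •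
    LinearMap.proj (fun s => α (q.succAbove s))

/-- Čech cocycles. -/
def cechCocycles (d : Divisor r) (p : ℕ) : Submodule ℂ ((Fin (p + 1) → Fin r) → CharRing) :=
  X.cechCochains d p ⊓ LinearMap.ker (cechDiff r p)

/-- Čech coboundaries. -/
def cechCoboundaries (d : Divisor r) :
    (p : ℕ) → Submodule ℂ ((Fin (p + 1) → Fin r) → CharRing)
  | 0 => ⊥
  | p + 1 => (X.cechCochains d p).map (cechDiff r p)

/-- The cohomology `Hᵖ(X, 𝒪(d))`. -/
abbrev lineBundleCohomology (d : Divisor r) (p : ℕ) : Type :=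
  X.cechCocycles d p ⧸ (X.cechCoboundaries d p).submoduleOf (X.cechCocycles d p)

/-- `Extᵖ(𝒪(d), 𝒪(d')) = Hᵖ(X, 𝒪(d' - d))`. -/
abbrev lineBundleExt (d d' : Divisor r) (p : ℕ) : Type :=
  X.lineBundleCohomology (d' - d) p

/-- The line bundles `𝒪(D 0), …, 𝒪(D (n - 1))` form a strong exceptional collection. -/
structure IsStrongExceptional {n : ℕ} (D : Fin n → Divisor r) : Prop where
  /-- `Ext⁰(E, E)` is one-dimensional for each member `E`. -/
  end_eq : ∀ j, Module.finrank ℂ (X.lineBundleExt (D j) (D j) 0) = 1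
  /-- There are no extensions in any degree from right to left. -/
  exceptional : ∀ j k, k < j → ∀ p, Subsingleton (X.lineBundleExt (D j) (D k) p)
  /-- Strength, together with the vanishing of `Extᵖ(E, E)` for `p ≠ 0`. -/
  strong : ∀ j k, ∀ p, p ≠ 0 → Subsingleton (X.lineBundleExt (D j) (D k) p)

/-! ## The endomorphism algebra of the direct sum and its simple modules -/

/-- `Hom(𝒪(d), 𝒪(d'))`, as the space of global sections of `𝒪(d' - d)`. -/
def homSections (d d' : Divisor r) : Submodule ℂ CharRing :=
  X.sectionsOn (d' - d) Finset.univ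

lemma mul_mem_homSections {d₁ d₂ d₃ : Divisor r} {f g : CharRing}
    (hf : f ∈ X.homSections d₂ d₃) (hg : g ∈ X.homSections d₁ d₂) :
    f * g ∈ X.homSections d₁ d₃ := by
  classical
  intro u hu i hi
  have h1 : u ∈ (f * g).coeff.support := by simpa using hu
  obtain ⟨a, ha, b, hb, rfl⟩ := Finset.mem_add.1 (AddMonoidAlgebra.support_coeff_mul_subset f g h1)
  have h2 := hf a (by simpa using ha) i hi
  have h3 := hg b (by simpa using hb) i hi
  simp only [latticePairing, Pi.sub_apply, Prod.fst_add, Prod.snd_add] at *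
  linarith

lemma one_mem_homSections (d : Divisor r) : (1 : CharRing) ∈ X.homSections d d := by
  classical
  intro u hu i _
  have : u = 0 := by
    by_contra h
    apply hu
    rw [AddMonoidAlgebra.one_def]
    simp [Ne.symm h]
  simp [this, latticePairing]

/-- The algebra `A = End(T)`, `T = ⨁ 𝒪(D j)`: matrices whose `(k, j)` entry lies in
`Hom(𝒪(D j), 𝒪(D k))`. It is the path algebra of the quiver with relations of the collection. -/
def endAlgebra {n : ℕ} (D : Fin n → Divisor r) : Subalgebra ℂ (Matrix (Fin n) (Fin n) CharRing) where
  carrier := {a | ∀ k j, a k j ∈ X.homSections (D j) (D k)}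
  add_mem' := fun ha hb k j => Submodule.add_mem _ (ha k j) (hb k j)
  mul_mem' := fun ha hb k j => by
    rw [Matrix.mul_apply]
    exact Submodule.sum_mem _ fun l _ => X.mul_mem_homSections (ha k l) (hb l j)
  algebraMap_mem' := fun c k j => by
    rw [Algebra.algebraMap_eq_smul_one, Matrix.smul_apply]
    refine Submodule.smul_mem _ _ ?_
    by_cases h : k = j
    · subst h
      simpa using X.one_mem_homSections (D k)
    · simp [h]

/-- A homomorphism, as a Čech cocycle of degree zero. -/
lemma const_mem_cechCocycles {d d' : Divisor r} {f : CharRing} (hf : f ∈ X.homSections d d') :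
    (fun _ => f) ∈ X.cechCocycles (d' - d) 0 := by
  refine ⟨fun α _ u hu i _ => hf u hu i (Finset.mem_univ i), ?_⟩
  change cechDiff r 0 _ = 0
  funext α
  simp [cechDiff, Fin.sum_univ_two]

/-- The embedding of homomorphisms into Čech cohomology in degree zero. -/
def homToExt (d d' : Divisor r) : X.homSections d d' →ₗ[ℂ] X.lineBundleExt d d' 0 :=
  (Submodule.mkQ ((X.cechCoboundaries (d' - d) 0).submoduleOf (X.cechCocycles (d' - d) 0))).comp
    ((LinearMap.pi fun _ => (X.homSections d d').subtype).codRestrict (X.cechCocycles (d' - d) 0)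
      fun f => X.const_mem_cechCocycles f.2)

lemma homToExt_injective (d d' : Divisor r) : Function.Injective (X.homToExt d d') := by
  rw [← LinearMap.ker_eq_bot, LinearMap.ker_eq_bot']
  intro f hf
  have h : (⟨fun _ => f.1, X.const_mem_cechCocycles f.2⟩ : X.cechCocycles (d' - d) 0) ∈
      (X.cechCoboundaries (d' - d) 0).submoduleOf (X.cechCocycles (d' - d) 0) :=
    (Submodule.Quotient.mk_eq_zero
      ((X.cechCoboundaries (d' - d) 0).submoduleOf (X.cechCocycles (d' - d) 0))).1 hf
  have h' : (fun _ => f.1 : (Fin 1 → Fin r) → CharRing) = 0 := by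
    simpa [Submodule.submoduleOf, cechCoboundaries] using h
  exact Subtype.ext (congrFun h' fun _ => 0)

variable {X} {n : ℕ} {D : Fin n → Divisor r}

lemma IsStrongExceptional.hom_eq_zero (hD : X.IsStrongExceptional D) {j k : Fin n} (h : k < j)
    {f : CharRing} (hf : f ∈ X.homSections (D j) (D k)) : f = 0 := by
  have := hD.exceptional j k h 0
  exact congrArg Subtype.val (X.homToExt_injective (D j) (D k)
    (Subsingleton.elim (X.homToExt _ _ ⟨f, hf⟩) (X.homToExt _ _ 0)))

lemma IsStrongExceptional.end_eq_smul_one (hD : X.IsStrongExceptional D) (j : Fin n)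
    {f : CharRing} (hf : f ∈ X.homSections (D j) (D j)) : ∃ c : ℂ, f = c • (1 : CharRing) := by
  let e := X.homToExt (D j) (D j)
  have he := X.homToExt_injective (D j) (D j)
  let o : X.homSections (D j) (D j) := ⟨1, X.one_mem_homSections (D j)⟩
  have ho : e o ≠ 0 := by
    intro h0
    have h1 : o = 0 := he (h0.trans (map_zero e).symm)
    exact one_ne_zero (congrArg Subtype.val h1)
  obtain ⟨c, hc⟩ := (finrank_eq_one_iff_of_nonzero' (e o) ho).1 (hD.end_eq j) (e ⟨f, hf⟩)
  refine ⟨c, ?_⟩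
  rw [← map_smul] at hc
  exact (congrArg Subtype.val (he hc)).symm

/-- The character of `A` at the vertex `i`: the scalar by which the `(i, i)` entry acts. -/
def IsStrongExceptional.vertexCharacter (hD : X.IsStrongExceptional D) (i : Fin n) :
    X.endAlgebra D →+* ℂ where
  toFun a := (a.1 i i).coeff 0
  map_one' := by simp [AddMonoidAlgebra.one_def]
  map_zero' := by simp
  map_add' := by simp
  map_mul' := by
    intro a b
    have h : (a * b).1 i i = a.1 i i * b.1 i i := by
      change (a.1 * b.1) i i = _
      rw [Matrix.mul_apply]
      refine Finset.sum_eq_single i ?_ (by simp)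
      intro l _ hl
      rcases lt_or_gt_of_ne hl with h | h
      · rw [hD.hom_eq_zero h (b.2 l i), mul_zero]
      · rw [hD.hom_eq_zero h (a.2 i l), zero_mul]
    obtain ⟨c, hc⟩ := hD.end_eq_smul_one i (a.2 i i)
    rw [h, hc]
    simp [AddMonoidAlgebra.one_def]

/-- The simple right `A`-module `S i`: one-dimensional over the vertex `i` and zero over the other
vertices. -/
def IsStrongExceptional.simpleModule (hD : X.IsStrongExceptional D) (i : Fin n) :
    ModuleCat.{0} (X.endAlgebra D)ᵐᵒᵖ :=
  (ModuleCat.restrictScalars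
    ((hD.vertexCharacter i).fromOpposite fun _ _ => Commute.all _ _)).obj (ModuleCat.of ℂ ℂ)

end ToricFanoSurface

/-! ## Graded spaces indexed by pairs of objects -/

section Graded

variable {ι : Type} [Fintype ι] [DecidableEq ι]

/-- The total space of a family `W d i j` (degree `d`, source `i`, target `j`). -/
abbrev TotalSpace (W : ℤ → ι → ι → Type) [∀ d i j, AddCommGroup (W d i j)] : Type :=
  DirectSum ℤ fun d => ∀ i j, W d i j

variable (W W' : ℤ → ι → ι → Type)
  [∀ d i j, AddCommGroup (W d i j)] [∀ d i j, Module ℂ (W d i j)]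
  [∀ d i j, AddCommGroup (W' d i j)] [∀ d i j, Module ℂ (W' d i j)]

/-- The inclusion of `W d i j` into the total space. -/
def totalEntry (d : ℤ) (i j : ι) : W d i j →ₗ[ℂ] TotalSpace W :=
  DirectSum.lof ℂ ℤ (fun d => ∀ i j, W d i j) d ∘ₗ
    LinearMap.single ℂ (fun i => ∀ j, W d i j) i ∘ₗ LinearMap.single ℂ (fun j => W d i j) j

/-- The elements of degree `d`. -/
def degreePart (d : ℤ) : Submodule ℂ (TotalSpace W) :=
  LinearMap.range (DirectSum.lof ℂ ℤ (fun d => ∀ i j, W d i j) d)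

variable {W W'}

/-- A `k`-ary operation is homogeneous of degree `s` and multilinear over the semisimple algebra
`ℂ^ι` of objects: it sends composable tuples `x₁, …, x_k`, with `x_p` from `o_p` to `o_{p-1}`, of
degrees `d_p` to elements of degree `∑ d_p + s` from `o_k` to `o_0`, and it vanishes on
noncomposable tuples. -/
def IsObjectwise {k : ℕ} (g : MultilinearMap ℂ (fun _ : Fin k => TotalSpace W) (TotalSpace W'))
    (s : ℤ) : Prop :=
  (∀ (d : Fin k → ℤ) (o : Fin (k + 1) → ι) (w : ∀ p : Fin k, W (d p) (o p.succ) (o p.castSucc)),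
    g (fun p => totalEntry W _ _ _ (w p)) ∈
      LinearMap.range (totalEntry W' ((∑ p, d p) + s) (o (Fin.last k)) (o 0))) ∧
  (∀ (d : Fin k → ℤ) (a b : Fin k → ι) (w : ∀ p : Fin k, W (d p) (a p) (b p)) (p q : Fin k),
    (p : ℕ) + 1 = q → a p ≠ b q → g (fun p => totalEntry W _ _ _ (w p)) = 0)

/-! ## `A∞`- and `L∞`-operations -/

/-- The sequence `x₀, …, x_{r-1}, m_s(x_r, …, x_{r+s-1}), x_{r+s}, …`. -/
def insertProduct {V : Type} [AddCommGroup V] [Module ℂ V]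
    (m : ∀ k, MultilinearMap ℂ (fun _ : Fin k => V) V) (x : ℕ → V) (r s : ℕ) : ℕ → V :=
  fun p => if p < r then x p else if p = r then m s (fun q : Fin s => x (r + q)) else x (p + s - 1)

/-- The sum `∑ (-1)^{r+st} g_{r+1+t} (1^{⊗r} ⊗ m_s ⊗ 1^{⊗t})` over `r + s + t = n`, `s ≥ 1`, applied
to `x₀, …, x_{n-1}` of degrees `d₀, …, d_{n-1}` with the Koszul sign rule (`m_s` has degree
`2 - s`). -/
def stasheffSum {V V' : Type} [AddCommGroup V] [Module ℂ V] [AddCommGroup V'] [Module ℂ V']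
    (m : ∀ k, MultilinearMap ℂ (fun _ : Fin k => V) V)
    (g : ∀ k, MultilinearMap ℂ (fun _ : Fin k => V) V') (d : ℕ → ℤ) (x : ℕ → V) (n : ℕ) : V' :=
  ∑ r ∈ Finset.range n, ∑ s ∈ Finset.Icc 1 (n - r),
    Int.negOnePow ((r : ℤ) + s * (n - r - s) + s * ∑ p ∈ Finset.range r, d p) •
      g (r + 1 + (n - r - s)) (fun p => insertProduct m x r s p)

/-- The projection onto the part of even (`q = 0`) or odd (`q = 1`) degree. -/
def parityProj (q : ZMod 2) : TotalSpace W →ₗ[ℂ] TotalSpace W :=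
  DirectSum.toModule ℂ ℤ _ fun d =>
    if (d : ZMod 2) = q then DirectSum.lof ℂ ℤ (fun d => ∀ i j, W d i j) d else 0

/-- The sign of the permutation `x₀, …, x_{k-1} ↦ x_{σ 0}, …, x_{σ (k-1)}` of elements with
parities `d`: the sign of `σ` times the Koszul sign. -/
def antisymmetricKoszulSign {k : ℕ} (σ : Equiv.Perm (Fin k)) (d : Fin k → ZMod 2) : ℤˣ :=
  Equiv.Perm.sign σ *
    ∏ p : Fin k, ∏ q : Fin k, if p < q ∧ σ q < σ p then (-1) ^ (d (σ p) * d (σ q)).val else 1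

/-- The graded antisymmetrization
`μ_k(x₁, …, x_k) = ∑_σ ± m_k(x_{σ 1}, …, x_{σ k})`; the outer sum decomposes the arguments into
their components of even and odd degree. -/
def antisymmetrization {k : ℕ}
    (m : MultilinearMap ℂ (fun _ : Fin k => TotalSpace W) (TotalSpace W)) :
    MultilinearMap ℂ (fun _ : Fin k => TotalSpace W) (TotalSpace W) :=
  ∑ d : Fin k → ZMod 2, ∑ σ : Equiv.Perm (Fin k), antisymmetricKoszulSign σ d •
    (m.domDomCongr σ).compLinearMap (fun p => parityProj (d p))

/-- A sign `ε k i d e` for each arity `k`, position `i`, parities `d` of `k` arguments and parity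
`e` of a further one. -/
abbrev RotationSign := (k : ℕ) → Fin k → (Fin k → ZMod 2) → ZMod 2 → ℤˣ

/-- The arguments `a_{i+1}, …, a_{k-1}, b, a_0, …, a_{i-1}`, with a zero in the place of `b`. -/
def rotatedArgs {V : Type} [Zero V] {k : ℕ} (a : Fin k → V) (i : Fin k) : Fin k → V :=
  fun p => if h : i.1 + 1 + p.1 < k then a ⟨i.1 + 1 + p.1, h⟩
    else if i.1 + 1 + p.1 = k then 0 else a ⟨i.1 + 1 + p.1 - k - 1, by omega⟩

/-- The place `k - 1 - i` of `b` in the rotated arguments. -/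
def rotatedPlace {k : ℕ} (i : Fin k) : Fin k := ⟨k - 1 - i.1, by omega⟩

/-- The brackets of the cyclic completion `L ⊕ L*[-3]` of `(L, μ)`, `L` finite-dimensional, whose
part of degree `i` is `Lⁱ ⊕ (L^{3-i})*`; in particular the functionals of parity `q` are those
that live on the part of `L` of parity `1 - q`. With `κ` the natural pairing of `L` with `L*`:
* if all inputs are in `L`, the bracket is `μ`;
* if more than one input is in `L*`, the bracket is zero;
* if the `i`-th input alone is in `L*`, the bracket is the element of `L*` with
  `κ(μ'(a₀, …, aᵢ*, …, a_{k-1}), b) = ε κ(μ(a_{i+1}, …, a_{k-1}, b, a₀, …, a_{i-1}), aᵢ*)`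
  for homogeneous elements.

The signs `ε` are those of a given rule, since conventions for the Koszul sign of the rotation
differ in the literature. -/
def cyclicCompletion (ε : RotationSign)
    (μ : ∀ k, MultilinearMap ℂ (fun _ : Fin k => TotalSpace W) (TotalSpace W)) (k : ℕ)
    (a : Fin k → TotalSpace W × Module.Dual ℂ (TotalSpace W)) :
    TotalSpace W × Module.Dual ℂ (TotalSpace W) :=
  (μ k fun p => (a p).1,
    ∑ i : Fin k, ∑ d : Fin k → ZMod 2, ∑ e : ZMod 2, ε k i d e •
      ((a i).2 ∘ₗ parityProj (1 - d i) ∘ₗ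
        (μ k).toLinearMap (rotatedArgs (fun p => parityProj (d p) (a p).1) i) (rotatedPlace i) ∘ₗ
        parityProj e))

end Graded

/-! ## The Yoneda algebra and its `A∞`-structure -/

section Yoneda

variable {ι : Type} [Fintype ι] [DecidableEq ι]
variable {C : Type 1} [Category.{0} C] [Preadditive C] [Linear ℂ C] (P : ι → CochainComplex C ℤ)

/-- Cocycles of degree `d` of the complex of morphisms between two complexes. -/
abbrev homCocycles (K L : CochainComplex C ℤ) (d : ℤ) : Submodule ℂ (Cochain K L d) :=
  LinearMap.ker (δ_hom ℂ K L d (d + 1))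

/-- The cohomology of degree `d` of the complex of morphisms between two complexes; for projective
resolutions `K` of `M` and `L` of `N` it is `Extᵈ(M, N)`. -/
abbrev homCohomology (K L : CochainComplex C ℤ) (d : ℤ) : Type :=
  homCocycles K L d ⧸
    (LinearMap.range (δ_hom ℂ K L (d - 1) d)).submoduleOf (homCocycles K L d)

/-- The components of the differential graded algebra `Hom^•(⨁ P i, ⨁ P i)`. -/
abbrev dgEnd (d : ℤ) (i j : ι) : Type := Cochain (P i) (P j) d

/-- The components of its cohomology, the Yoneda algebra. -/
abbrev yonedaAlg (d : ℤ) (i j : ι) : Type := homCohomology (P i) (P j) d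

/-- The differential. -/
def dgEndDiff : TotalSpace (dgEnd P) →ₗ[ℂ] TotalSpace (dgEnd P) :=
  DirectSum.toModule ℂ ℤ _ fun d =>
    DirectSum.lof ℂ ℤ (fun d => ∀ i j, dgEnd P d i j) (d + 1) ∘ₗ
      LinearMap.pi fun i => LinearMap.pi fun j =>
        δ_hom ℂ (P i) (P j) d (d + 1) ∘ₗ LinearMap.proj j ∘ₗ LinearMap.proj i

/-- The product `f ∘ g` (first `g`, then `f`) of homogeneous elements. -/
def dgEndComp (d e : ℤ) : (∀ i j, dgEnd P d i j) →ₗ[ℂ] (∀ i j, dgEnd P e i j) →ₗ[ℂ]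
    (∀ i j, dgEnd P (d + e) i j) :=
  LinearMap.mk₂ ℂ (fun f g i j => ∑ l, (g i l).comp (f l j) (add_comm e d))
    (fun f f' g => by funext i j; simp [Finset.sum_add_distrib])
    (fun c f g => by funext i j; simp [Finset.smul_sum])
    (fun f g g' => by funext i j; simp [Finset.sum_add_distrib])
    (fun c f g => by funext i j; simp [Finset.smul_sum])

/-- The product `f ∘ g`. -/
def dgEndMul : TotalSpace (dgEnd P) →ₗ[ℂ] TotalSpace (dgEnd P) →ₗ[ℂ] TotalSpace (dgEnd P) :=
  DirectSum.toModule ℂ ℤ _ fun d => LinearMap.flip <|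
    DirectSum.toModule ℂ ℤ _ fun e => LinearMap.flip <|
      (dgEndComp P d e).compr₂ (DirectSum.lof ℂ ℤ (fun d => ∀ i j, dgEnd P d i j) (d + e))

/-- The `A∞`-structure of the Yoneda algebra: a minimal `A∞`-structure on the cohomology of the
differential graded algebra `Hom^•(⨁ P i, ⨁ P i)`, over the semisimple algebra of objects, with an
`A∞`-quasi-isomorphism to that algebra which lifts the identity in cohomology. Such a structure
exists and is unique up to (noncanonical) `A∞`-isomorphism. -/
structure YonedaAInfinity where
  /-- The products. -/
  m : ∀ k, MultilinearMap ℂ (fun _ : Fin k => TotalSpace (yonedaAlg P)) (TotalSpace (yonedaAlg P))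
  m_objectwise : ∀ k : ℕ, 1 ≤ k → IsObjectwise (m k) (2 - k)
  m_one : m 1 = 0
  /-- The `A∞`-relations. -/
  m_relation : ∀ (n : ℕ) (d : ℕ → ℤ) (x : ℕ → TotalSpace (yonedaAlg P)), 1 ≤ n →
    (∀ p, x p ∈ degreePart (yonedaAlg P) (d p)) → stasheffSum m m d x n = (0 : TotalSpace (yonedaAlg P))
  /-- The components of the quasi-isomorphism. -/
  f : ∀ k, MultilinearMap ℂ (fun _ : Fin k => TotalSpace (yonedaAlg P)) (TotalSpace (dgEnd P))
  f_objectwise : ∀ k : ℕ, 1 ≤ k → IsObjectwise (f k) (1 - k)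
  /-- The relations of an `A∞`-morphism to a differential graded algebra. -/
  f_relation : ∀ (n : ℕ) (d : ℕ → ℤ) (x : ℕ → TotalSpace (yonedaAlg P)), 1 ≤ n →
    (∀ p, x p ∈ degreePart (yonedaAlg P) (d p)) →
    stasheffSum m f d x n = dgEndDiff P (f n fun p => x p) +
      ∑ i ∈ Finset.Ico 1 n,
        Int.negOnePow ((i - 1 : ℤ) + (1 - (n - i)) * ∑ p ∈ Finset.range i, d p) •
          dgEndMul P (f i fun p => x p) (f (n - i) fun p => x (i + p))
  /-- The first component lifts the identity in cohomology. -/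
  f_one : ∀ (d : ℤ) (i j : ι) (z : homCocycles (P i) (P j) d),
    f 1 (fun _ => totalEntry (yonedaAlg P) d i j (Submodule.Quotient.mk z)) -
      totalEntry (dgEnd P) d i j z.1 ∈ LinearMap.range (dgEndDiff P)

/-- The products `μ_k` of the `L∞`-algebra `L` associated with the Yoneda algebra. -/
def YonedaAInfinity.bracket {P : ι → CochainComplex C ℤ} (R : YonedaAInfinity P) (k : ℕ) :
    MultilinearMap ℂ (fun _ : Fin k => TotalSpace (yonedaAlg P)) (TotalSpace (yonedaAlg P)) :=
  antisymmetrization (R.m k)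

end Yoneda

end

/-! The vanishing of `m k` is a degree count that works as soon as `k` exceeds both `2` and the
length `n` of the collection; the toric geometry is needed only for `n ≤ χ(X)`.

Degree count. `A` is triangular with one-dimensional diagonal blocks, so the syzygies of a simple
module move strictly down the order of the vertices. Hence Extᵈ(Sᵢ, Sⱼ) vanishes unless 0 ≤ d ≤ i -
j, and degree 0 occurs only for i = j. For composable inputs the bounds telescope: the degrees add
up to at most o_k - o_0 ≤ n - 1. The output of `m k` then has degree at most 2 - k < 0 if the end
vertices agree, and at most n + 1 - k ≤ 0 if they differ; in both cases it lies in a zero group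
(`YonedaAInfinity.m_eq_zero`). The brackets on L and on its cyclic completion are built linearly
from `m k`.

Bound on n. The classes of an exceptional collection are independent because the Euler form is
unitriangular on them, and K₀(X) has rank at most χ(X). The argument runs in the dual of K₀. The
function F(d) = χ(𝒪(d)) on ℤʳ, a finite sum over characters, is invariant under principal divisors
and satisfies the Stanley–Reisner difference equations. Its translates by -D j are independent
because F(D i - D j) is unitriangular. A shelling of the fan bounds the space of solutions of these
equations: each maximal cone contributes functions on a finite group of order det(vᵢ, vᵢ₊₁), and
these orders add up to χ(X) (`eq_zero_of_shellOp`). -/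

noncomputable section

/-! ### Ext groups and complexes of morphisms between resolutions -/

section

variable {C : Type 1} [Category.{0} C] [Abelian C] [Linear ℂ C]

lemma homCohomology_subsingleton_iff (K L : CochainComplex C ℤ) (d : ℤ) :
    Subsingleton (homCohomology K L d) ↔ Subsingleton (CohomologyClass K L d) := by
  have h1 : Subsingleton (homCohomology K L d) ↔
      ∀ z : Cochain K L d, δ d (d + 1) z = 0 → ∃ y, δ (d - 1) d y = z := by
    rw [Submodule.Quotient.subsingleton_iff, Submodule.submoduleOf,
      Submodule.eq_top_iff']
    simp
  rw [h1]
  constructor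
  · intro h
    refine subsingleton_of_forall_eq 0 fun x => ?_
    obtain ⟨z, rfl⟩ := x.mk_surjective
    rw [CohomologyClass.mk_eq_zero_iff, mem_coboundaries_iff _ (d - 1) (by simp)]
    exact h z.1 (Cocycle.δ_eq_zero z _)
  · intro h z hz
    have := Subsingleton.elim (CohomologyClass.mk (Cocycle.mk z (d + 1) rfl hz)) 0
    rwa [CohomologyClass.mk_eq_zero_iff, mem_coboundaries_iff _ (d - 1) (by simp)] at this

-- Maps out of a K-projective complex are the same in the homotopy and in the derived category. In
-- the latter `φ` is invertible, so a class that dies after composition with `φ` is zero.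
omit [Linear ℂ C] in
attribute [local instance] HasDerivedCategory.standard in
lemma cohomologyClass_subsingleton_of_quasiIso {K L L' : CochainComplex C ℤ} [K.IsKProjective]
    (φ : L ⟶ L') [QuasiIso φ] (d : ℤ) (h : Subsingleton (CohomologyClass K L' d)) :
    Subsingleton (CohomologyClass K L d) := by
  refine subsingleton_of_forall_eq 0 fun x => ?_
  apply (CohomologyClass.toHom_bijective K L d).1
  rw [map_zero]
  obtain ⟨z, rfl⟩ := x.mk_surjective
  rw [CohomologyClass.toHom_mk]
  set f := Cocycle.equivHomShift.symm z
  have h1 : (HomotopyCategory.quotient C _).map (f ≫ φ⟦d⟧') = 0 := by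
    have := CohomologyClass.toHom_mk (Cocycle.equivHomShift (f ≫ φ⟦d⟧'))
    rw [AddEquiv.symm_apply_apply] at this
    rw [← this, Subsingleton.elim (CohomologyClass.mk _) 0, map_zero]
  have h2 : DerivedCategory.Q.map f ≫ DerivedCategory.Q.map (φ⟦d⟧') = 0 := by
    rw [← Functor.map_comp, ← cancel_epi ((DerivedCategory.quotientCompQhIso C).hom.app K),
      ← NatTrans.naturality]
    simp only [Functor.comp_map, h1]
    simp
  have : IsIso (DerivedCategory.Q.map (φ⟦d⟧')) := by
    have : QuasiIso (φ⟦d⟧') := (CochainComplex.quasiIso_shift_iff φ d).2 inferInstance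
    infer_instance
  have h3 : DerivedCategory.Q.map f = 0 := by
    rw [← cancel_mono (DerivedCategory.Q.map (φ⟦d⟧')), h2, Limits.zero_comp]
  apply (CochainComplex.IsKProjective.Qh_map_bijective K _).1
  rw [Functor.map_zero, ← cancel_mono ((DerivedCategory.quotientCompQhIso C).hom.app _),
    ← Functor.comp_map, NatTrans.naturality, h3]
  simp

/-- The resolution of `N` may be replaced by `N` itself, which turns cohomology classes into Ext. In
negative degrees there are no cochains at all: the resolution of `M` lives in degrees at most 0 and
`N` in degree 0. -/
lemma yoneda_subsingleton [HasExt.{0} C] {M N : C} (P : ProjectiveResolution M)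
    (Q : ProjectiveResolution N) (d : ℤ)
    (h : ∀ n : ℕ, (n : ℤ) = d → Subsingleton (Abelian.Ext M N n)) :
    Subsingleton (homCohomology P.cochainComplex Q.cochainComplex d) := by
  rw [homCohomology_subsingleton_iff]
  apply cohomologyClass_subsingleton_of_quasiIso Q.π' d
  rcases lt_or_ge d 0 with hd | hd
  · refine subsingleton_of_forall_eq 0 fun x => ?_
    obtain ⟨z, rfl⟩ := x.mk_surjective
    rw [show z = 0 from ?_, CohomologyClass.mk_zero]
    ext p q hpq
    rcases lt_or_ge 0 p with hp | hp
    · exact (P.cochainComplex.isZero_of_isStrictlyLE 0 p hp).eq_of_src _ _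
    · exact (CochainComplex.isZero_of_isStrictlyGE ((CochainComplex.singleFunctor C 0).obj N) 0 q
        (by omega)).eq_of_tgt _ _
  · obtain ⟨n, rfl⟩ := Int.eq_ofNat_of_zero_le hd
    have := h n rfl
    exact (P.extEquivCohomologyClass (Y := N) (n := n)).symm.subsingleton

end

/-! ### Ext vanishing over triangular algebras -/

/-- Orthogonal idempotents `e 0, …, e (n - 1)` with sum one that make `B` a lower triangular
algebra with one-dimensional diagonal blocks. -/
structure IsTriangularIdempotents {B : Type} [Ring B] [Algebra ℂ B] {n : ℕ} (e : Fin n → B) :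
    Prop where
  orthogonal : CompleteOrthogonalIdempotents e
  triangular : ∀ j k b, k < j → e j * b * e k = 0
  diagonal : ∀ i b, ∃ c : ℂ, e i * b * e i = c • e i

namespace IsTriangularIdempotents

variable {B : Type} [Ring B] [Algebra ℂ B] {n : ℕ} {e : Fin n → B}

/-- The elements of `M` killed by `e i`, a submodule if `e k` kills `M` for all `k > i`. -/
def lowerPart (he : IsTriangularIdempotents e) {M : Type} [AddCommGroup M] [Module B M] (i : Fin n)
    (hM : ∀ k, i < k → ∀ m : M, e k • m = 0) : Submodule B M where
  carrier := {m | e i • m = 0}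
  add_mem' := fun {a b} (ha : e i • a = 0) (hb : e i • b = 0) => by simp [ha, hb]
  zero_mem' := smul_zero _
  smul_mem' := fun b m (hm : e i • m = 0) => by
    change e i • b • m = 0
    have h : m = ∑ k, e k • m := by rw [← Finset.sum_smul, he.orthogonal.complete, one_smul]
    rw [h, Finset.smul_sum, Finset.smul_sum]
    refine Finset.sum_eq_zero fun k _ => ?_
    rcases lt_trichotomy k i with hk | rfl | hk
    · rw [← mul_smul, ← mul_smul, he.triangular i k b hk, zero_smul]
    · rw [hm, smul_zero, smul_zero]
    · rw [hM k hk, smul_zero, smul_zero]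

/-- The cover is a sum of copies of B eᵢ indexed by a ℂ-basis of `T`. Its kernel lies strictly below
`i`: eₖ B eᵢ = 0 for k > i, and eᵢ B eᵢ = ℂ eᵢ makes the part of the cover at `i` a copy of `T`. -/
lemma exists_projective_cover (he : IsTriangularIdempotents e) {T : Type} [AddCommGroup T]
    [Module B T] [Module ℂ T] [IsScalarTower ℂ B T] (i : Fin n)
    (hT : ∀ k, k ≠ i → ∀ t : T, e k • t = 0) :
    ∃ (F : ModuleCat.{0} B) (f : F →ₗ[B] T), Projective F ∧ Function.Surjective f ∧
      ∀ x, f x = 0 → ∀ k, i ≤ k → e k • x = 0 := by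
  classical
  have hei : ∀ t : T, e i • t = t := fun t => by
    conv_rhs => rw [← one_smul B t, ← he.orthogonal.complete, Finset.sum_smul]
    exact (Finset.sum_eq_single i (fun k _ hk => hT k hk t) (by simp)).symm
  let I : Submodule B B := LinearMap.range (LinearMap.toSpanSingleton B B (e i))
  have hI : ∀ x ∈ I, x * e i = x := by
    rintro _ ⟨b, rfl⟩
    simp [mul_assoc, (he.orthogonal.idem i).eq]
  have : Module.Projective B I := by
    refine Module.Projective.of_split I.subtype
      (LinearMap.rangeRestrict (LinearMap.toSpanSingleton B B (e i))) ?_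
    ext x
    simpa using hI x.1 x.2
  let v := Module.Basis.ofVectorSpace ℂ T
  let ι := Module.Basis.ofVectorSpaceIndex ℂ T
  let f : (DirectSum ι fun _ => I) →ₗ[B] T :=
    DirectSum.toModule B ι T fun t => (LinearMap.toSpanSingleton B T (v t)) ∘ₗ I.subtype
  refine ⟨ModuleCat.of B (DirectSum ι fun _ => I), f, ?_, ?_, ?_⟩
  · rw [← IsProjective.iff_projective]
    infer_instance
  · rw [← LinearMap.range_eq_top, ← Submodule.restrictScalars_eq_top_iff ℂ, eq_top_iff,
      ← v.span_eq, Submodule.span_le]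
    rintro _ ⟨t, rfl⟩
    refine ⟨DirectSum.lof B ι (fun _ => I) t ⟨e i, 1, by simp⟩, ?_⟩
    simp [f, hei]
  · intro x hx k hk
    have hc : ∀ t, ∃ c : ℂ, e k * (x t : B) = c • e i := by
      intro t
      rcases hk.lt_or_eq with hk | rfl
      · exact ⟨0, by rw [← hI _ (x t).2, ← mul_assoc, he.triangular k i _ hk, zero_smul]⟩
      · obtain ⟨c, hc⟩ := he.diagonal i (x t)
        exact ⟨c, by rw [← hc, mul_assoc, hI _ (x t).2]⟩
    choose c hc using hc
    -- This is `e k • f x = 0` written in the basis `v`, whose independence forces all `c t` to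
    -- vanish.
    have hsum : ∑ t ∈ DFinsupp.support x, c t • v t = 0 := by
      rw [← smul_zero (e k), ← hx]
      conv_rhs => rw [← DirectSum.sum_support_of x]
      rw [map_sum, Finset.smul_sum]
      refine Finset.sum_congr rfl fun t _ => ?_
      have : f (DirectSum.of (fun _ => I) t (x t)) = (x t : B) • v t := by
        simp [f, ← DirectSum.lof_eq_of B]
      rw [this, ← mul_smul, hc, smul_assoc, hei]
    have hc0 := linearIndependent_iff'.1 v.linearIndependent _ _ hsum
    refine DFinsupp.ext fun t => Subtype.ext ?_
    change e k * (x t : B) = 0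
    by_cases ht : t ∈ DFinsupp.support x
    · rw [hc, hc0 t ht, zero_smul]
    · rw [DFinsupp.notMem_support_iff.1 ht]
      exact mul_zero _

lemma ext_subsingleton_of_concentrated (he : IsTriangularIdempotents e) (N : ModuleCat.{0} B)
    (j : Fin n) (hN : ∀ k, k ≠ j → ∀ x : N, e k • x = 0) (i : Fin n)
    (ih : ∀ (M : ModuleCat.{0} B), (∀ k : Fin n, i ≤ k → ∀ m : M, e k • m = 0) →
      ∀ d : ℕ, (i : ℕ) ≤ d + j → Subsingleton (Abelian.Ext M N d))
    (T : ModuleCat.{0} B) (hT : ∀ k, k ≠ i → ∀ t : T, e k • t = 0) (d : ℕ)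
    (hd : (i : ℕ) + 1 ≤ d + j) : Subsingleton (Abelian.Ext T N d) := by
  cases d with
  | zero =>
    refine Abelian.Ext.homEquiv₀.subsingleton_congr.2 (subsingleton_of_forall_eq 0 fun g => ?_)
    ext t
    have hij : j ≠ i := by
      rintro rfl
      omega
    rw [← one_smul B t, ← he.orthogonal.complete, Finset.sum_smul, map_sum]
    refine Finset.sum_eq_zero fun k _ => ?_
    by_cases hk : k = i
    · subst hk
      rw [map_smul]
      exact hN k hij.symm _
    · rw [hT k hk, map_zero]
  | succ d =>
    let _ : Module ℂ T := Module.restrictScalars ℂ B T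
    have : IsScalarTower ℂ B T := IsScalarTower.restrictScalars ℂ B T
    obtain ⟨F, f, hF, hf, hK⟩ := he.exists_projective_cover i hT
    have hS := LinearMap.shortExact_shortComplexKer hf
    have hsub := ih (ModuleCat.of B (LinearMap.ker f))
      (fun k hk m => Subtype.ext (hK m.1 m.2 k hk)) d (by omega)
    refine subsingleton_of_forall_eq 0 fun x => ?_
    obtain ⟨y, rfl⟩ := Abelian.Ext.contravariant_sequence_exact₃ hS N x
      (have : Projective f.shortComplexKer.X₂ := hF
       Abelian.Ext.eq_zero_of_projective _) (add_comm 1 d)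
    have : y = 0 := hsub.elim _ _
    rw [this, Abelian.Ext.comp_zero]

/-- If `e k` kills `M` for `k ≥ i` and `N` for `k ≠ j`, then `Extᵈ(M, N) = 0` for `d ≥ i - j`. -/
lemma ext_subsingleton (he : IsTriangularIdempotents e) (N : ModuleCat.{0} B) (j : Fin n)
    (hN : ∀ k, k ≠ j → ∀ x : N, e k • x = 0) (i : ℕ) :
    ∀ (M : ModuleCat.{0} B), (∀ k : Fin n, i ≤ k → ∀ m : M, e k • m = 0) →
      ∀ d : ℕ, i ≤ d + j → Subsingleton (Abelian.Ext M N d) := by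
  induction i with
  | zero =>
    intro M hM d _
    have : Subsingleton M := by
      refine subsingleton_of_forall_eq 0 fun m => ?_
      rw [← one_smul B m, ← he.orthogonal.complete, Finset.sum_smul]
      exact Finset.sum_eq_zero fun k _ => hM k (Nat.zero_le _) m
    have : HasProjectiveDimensionLT M 0 :=
      (ModuleCat.isZero_of_subsingleton M).hasProjectiveDimensionLT_zero
    exact HasProjectiveDimensionLT.subsingleton M 0 d (Nat.zero_le _) N
  | succ i ih =>
    intro M hM d hd
    by_cases hi : i < n
    · have hM' : ∀ k, ⟨i, hi⟩ < k → ∀ m : M, e k • m = 0 := fun k hk => hM k hk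
      -- `M'` lives strictly below `i` and `M ⧸ M'` at `i` alone, so the long exact sequence reduces
      -- `M` to these two.
      let M' := he.lowerPart ⟨i, hi⟩ hM'
      have hS := LinearMap.shortExact_shortComplexKer M'.mkQ_surjective
      have h1 : Subsingleton (Abelian.Ext (ModuleCat.of B (LinearMap.ker M'.mkQ)) N d) := by
        refine ih _ (fun k hk m => Subtype.ext ?_) d (by omega)
        have hm : e ⟨i, hi⟩ • (m : M) = 0 := (Submodule.Quotient.mk_eq_zero M').1 m.2
        rcases hk.eq_or_lt with hk | hk
        · rwa [show k = ⟨i, hi⟩ from Fin.ext hk.symm]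
        · exact hM' k hk m
      have h3 : Subsingleton (Abelian.Ext (ModuleCat.of B (M ⧸ M')) N d) := by
        refine he.ext_subsingleton_of_concentrated N j hN ⟨i, hi⟩ (fun M hM => ih M fun k => hM k)
          (ModuleCat.of B (M ⧸ M')) (fun k hk t => ?_) d hd
        obtain ⟨m, rfl⟩ := M'.mkQ_surjective t
        change Submodule.Quotient.mk (p := M') (e k • m) = 0
        rw [Submodule.Quotient.mk_eq_zero]
        change e ⟨i, hi⟩ • e k • m = 0
        rw [← mul_smul, he.orthogonal.ortho hk.symm, zero_smul]
      refine subsingleton_of_forall_eq 0 fun x => ?_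
      obtain ⟨y, rfl⟩ := Abelian.Ext.contravariant_sequence_exact₂ hS N x (h1.elim _ _)
      have : y = 0 := h3.elim _ _
      rw [this, Abelian.Ext.comp_zero]
    · exact ih M (fun k _ => absurd k.2 (by omega)) d (by omega)

end IsTriangularIdempotents

/-! ### The simple modules of the endomorphism algebra -/

namespace ToricFanoSurface

variable {r : ℕ} [NeZero r] {X : ToricFanoSurface r} {n : ℕ} {D : Fin n → Divisor r}

/-- The idempotent of the endomorphism algebra at the vertex `i`. -/
def vertexIdempotent (X : ToricFanoSurface r) (D : Fin n → Divisor r) (i : Fin n) :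
    X.endAlgebra D :=
  ⟨Matrix.single i i 1, fun k j => by
    by_cases h : i = k ∧ i = j
    · obtain ⟨rfl, rfl⟩ := h
      simpa using X.one_mem_homSections (D i)
    · rw [Matrix.single_apply_of_ne _ _ _ _ _ h]
      exact Submodule.zero_mem _⟩

lemma vertexIdempotent_mul_mul (a : X.endAlgebra D) (j k : Fin n) :
    (vertexIdempotent X D k * a * vertexIdempotent X D j).1 = Matrix.single k j (a.1 k j) := by
  change Matrix.single k k 1 * a.1 * Matrix.single j j 1 = _
  rw [Matrix.single_mul_mul_single, one_mul, mul_one]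

/-- Right modules are left modules over the opposite algebra, where multiplication is reversed: `e j
* b * e k` is the matrix entry (k, j), an element of Hom(𝒪(D j), 𝒪(D k)), which is zero for k < j.
-/
lemma IsStrongExceptional.isTriangularIdempotents (hD : X.IsStrongExceptional D) :
    IsTriangularIdempotents fun i => MulOpposite.op (vertexIdempotent X D i) where
  orthogonal := by
    refine ⟨⟨fun i => ?_, fun i j hij => ?_⟩, ?_⟩
    · refine congrArg MulOpposite.op (Subtype.ext ?_)
      change Matrix.single i i 1 * Matrix.single i i 1 = _
      rw [Matrix.single_mul_single_same, mul_one]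
      rfl
    · refine congrArg MulOpposite.op (Subtype.ext ?_)
      change Matrix.single j j 1 * Matrix.single i i 1 = _
      rw [Matrix.single_mul_single_of_ne _ _ _ _ hij.symm]
      rfl
    · rw [← Finset.op_sum, ← MulOpposite.op_one]
      refine congrArg MulOpposite.op (Subtype.ext ?_)
      rw [AddSubmonoidClass.coe_finsetSum]
      exact Matrix.sum_single_one
  triangular j k b h := by
    refine MulOpposite.unop_injective (Subtype.ext ?_)
    rw [MulOpposite.unop_mul, MulOpposite.unop_mul, ← mul_assoc]
    refine (vertexIdempotent_mul_mul _ _ _).trans ?_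
    rw [hD.hom_eq_zero h (b.unop.2 k j), Matrix.single_zero]
    rfl
  diagonal i b := by
    obtain ⟨c, hc⟩ := hD.end_eq_smul_one i (b.unop.2 i i)
    refine ⟨c, MulOpposite.unop_injective (Subtype.ext ?_)⟩
    rw [MulOpposite.unop_mul, MulOpposite.unop_mul, ← mul_assoc]
    refine (vertexIdempotent_mul_mul _ _ _).trans ?_
    rw [hc]
    exact (Matrix.smul_single c i i 1).symm

lemma IsStrongExceptional.vertexIdempotent_smul (hD : X.IsStrongExceptional D) {i k : Fin n}
    (h : k ≠ i) (x : hD.simpleModule i) : MulOpposite.op (vertexIdempotent X D k) • x = 0 := by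
  have h1 : hD.vertexCharacter i (vertexIdempotent X D k) = 0 := by
    change ((Matrix.single k k 1 : Matrix (Fin n) (Fin n) CharRing) i i).coeff 0 = 0
    rw [Matrix.single_apply_of_ne _ _ _ _ _ (fun h' => h h'.1)]
    rfl
  change (hD.vertexCharacter i (vertexIdempotent X D k) * (show ℂ from x) : ℂ) = 0
  rw [h1, zero_mul]

/-- `Extᵈ(Sᵢ, Sⱼ)` vanishes unless `0 ≤ d ≤ i - j`, where `d = 0` only for `i = j`. -/
lemma IsStrongExceptional.yonedaAlg_subsingleton (hD : X.IsStrongExceptional D)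
    (P : ∀ i, ProjectiveResolution (hD.simpleModule i)) (d : ℤ) (i j : Fin n)
    (h : d < 0 ∨ (i : ℤ) - j < d ∨ d = 0 ∧ i ≠ j) :
    Subsingleton (yonedaAlg (fun i => (P i).cochainComplex) d i j) := by
  refine yoneda_subsingleton (P i) (P j) d ?_
  rintro m rfl
  have he := hD.isTriangularIdempotents
  rcases h with h | h | ⟨h, hij⟩
  · omega
  -- Sᵢ is killed by the idempotents from `i + 1` on, so the threshold is d ≥ i + 1 - j.
  · exact he.ext_subsingleton _ j (fun k hk x => hD.vertexIdempotent_smul hk x) (i + 1) _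
      (fun k hk x => hD.vertexIdempotent_smul (by rintro rfl; omega) x) m (by omega)
  · obtain rfl : m = 0 := by omega
    refine Abelian.Ext.homEquiv₀.subsingleton_congr.2 (subsingleton_of_forall_eq 0 fun g => ?_)
    ext t
    rw [← one_smul (X.endAlgebra D)ᵐᵒᵖ t, ← he.orthogonal.complete, Finset.sum_smul, map_sum]
    refine Finset.sum_eq_zero fun k _ => ?_
    by_cases hk : k = i
    · subst hk
      rw [map_smul]
      exact hD.vertexIdempotent_smul hij _
    · rw [hD.vertexIdempotent_smul hk, map_zero]

end ToricFanoSurface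

/-! ### Degree count for the products `m k` -/

section Graded

variable {ι : Type} [Fintype ι] [DecidableEq ι]
variable {W W' : ℤ → ι → ι → Type}
  [∀ d i j, AddCommGroup (W d i j)] [∀ d i j, Module ℂ (W d i j)]
  [∀ d i j, AddCommGroup (W' d i j)] [∀ d i j, Module ℂ (W' d i j)]

lemma span_totalEntry :
    Submodule.span ℂ {x : TotalSpace W | ∃ d i j w, totalEntry W d i j w = x} = ⊤ := by
  rw [eq_top_iff]
  rintro x -
  induction x using DirectSum.induction_on with
  | zero => exact Submodule.zero_mem _
  | add x y hx hy => exact Submodule.add_mem _ hx hy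
  | of d y =>
    have : DirectSum.of (fun d => ∀ i j, W d i j) d y =
        ∑ i, ∑ j, totalEntry W d i j (y i j) := by
      have h : y = ∑ i, ∑ j, LinearMap.single ℂ (fun i => ∀ j, W d i j) i
          (LinearMap.single ℂ (fun j => W d i j) j (y i j)) := by
        conv_lhs => rw [← Finset.univ_sum_single y]
        refine Finset.sum_congr rfl fun i _ => ?_
        rw [← map_sum]
        exact congrArg _ (Finset.univ_sum_single (y i)).symm
      conv_lhs => rw [h, ← DirectSum.lof_eq_of ℂ]
      simp only [map_sum]
      rfl
    rw [this]
    exact Submodule.sum_mem _ fun i _ => Submodule.sum_mem _ fun j _ =>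
      Submodule.subset_span ⟨d, i, j, _, rfl⟩

/-- Induction on the set of slots whose arguments are allowed to leave `s`, releasing one slot at a
time. -/
lemma multilinearMap_eq_zero_of_span {V V' : Type} [AddCommGroup V] [Module ℂ V] [AddCommGroup V']
    [Module ℂ V'] {k : ℕ} (g : MultilinearMap ℂ (fun _ : Fin k => V) V') (s : Set V)
    (hs : Submodule.span ℂ s = ⊤) (h : ∀ x : Fin k → V, (∀ p, x p ∈ s) → g x = 0) : g = 0 := by
  have key : ∀ (t : Finset (Fin k)) (x : Fin k → V), (∀ p, p ∉ t → x p ∈ s) → g x = 0 := by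
    intro t
    induction t using Finset.induction_on with
    | empty => exact fun x hx => h x fun p => hx p (by simp)
    | insert a t ha ih =>
      intro x hx
      have hle : Submodule.span ℂ s ≤ LinearMap.ker (g.toLinearMap x a) := by
        rw [Submodule.span_le]
        intro y hy
        refine ih _ fun p hp => ?_
        by_cases hpa : p = a
        · subst hpa
          simpa using hy
        · simpa [hpa] using hx p (by simp [hpa, hp])
      have : g.toLinearMap x a (x a) = 0 := hle (hs ▸ Submodule.mem_top)
      simpa using this
  ext x
  exact key Finset.univ x (by simp)

lemma IsObjectwise.eq_zero {k : ℕ}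
    {g : MultilinearMap ℂ (fun _ : Fin k => TotalSpace W) (TotalSpace W')} {s : ℤ}
    (hg : IsObjectwise g s) (hk : 1 ≤ k)
    (h : ∀ (d : Fin k → ℤ) (o : Fin (k + 1) → ι),
      (∃ p, Subsingleton (W (d p) (o p.succ) (o p.castSucc))) ∨
        Subsingleton (W' ((∑ p, d p) + s) (o (Fin.last k)) (o 0))) : g = 0 := by
  refine multilinearMap_eq_zero_of_span g _ span_totalEntry fun x hx => ?_
  choose d a b w hw using hx
  obtain rfl : (fun p => totalEntry W (d p) (a p) (b p) (w p)) = x := funext hw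
  by_cases hc : ∃ p q : Fin k, (p : ℕ) + 1 = q ∧ a p ≠ b q
  · obtain ⟨p, q, hpq, hne⟩ := hc
    exact hg.2 d a b w p q hpq hne
  push Not at hc
  obtain ⟨o, ha, hb⟩ : ∃ o : Fin (k + 1) → ι,
      a = (fun p => o p.succ) ∧ b = fun p => o p.castSucc := by
    -- The chain of objects is the target of the first argument followed by all the sources.
    refine ⟨Fin.cons (b ⟨0, hk⟩) a, by simp, funext fun p => ?_⟩
    obtain ⟨p, hp⟩ := p
    cases p with
    | zero => rfl
    | succ p => exact (hc ⟨p, by omega⟩ ⟨p + 1, hp⟩ rfl).symm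
  subst ha hb
  rcases h d o with ⟨p, hp⟩ | h
  · refine g.map_coord_zero p ?_
    rw [hp.elim (w p) 0, map_zero]
  · obtain ⟨y, hy⟩ := hg.1 d o w
    rw [← hy, h.elim y 0, map_zero]

end Graded

lemma YonedaAInfinity.m_eq_zero {r : ℕ} [NeZero r] {X : ToricFanoSurface r} {n : ℕ}
    {D : Fin n → ToricFanoSurface.Divisor r} (hD : X.IsStrongExceptional D)
    (P : ∀ i, ProjectiveResolution (hD.simpleModule i))
    (R : YonedaAInfinity fun i => (P i).cochainComplex) {k : ℕ} (hk : 3 ≤ k) (hn : n < k) :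
    R.m k = 0 := by
  refine (R.m_objectwise k (by omega)).eq_zero (by omega) fun d o => ?_
  by_contra! hcon
  obtain ⟨h1, h2⟩ := hcon
  have h3 : ∀ p, d p ≤ (o p.succ : ℤ) - o p.castSucc := by
    intro p
    by_contra! hp
    exact not_subsingleton_iff_nontrivial.2 (h1 p)
      (hD.yonedaAlg_subsingleton P _ _ _ (Or.inr (Or.inl hp)))
  have h4 : ∑ p, d p ≤ (o (Fin.last k) : ℤ) - o 0 := by
    refine (Finset.sum_le_sum fun p _ => h3 p).trans_eq ?_
    have := Fin.sum_univ_castSucc (fun p => ((o p : ℕ) : ℤ))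
    have := Fin.sum_univ_succ (fun p => ((o p : ℕ) : ℤ))
    rw [Finset.sum_sub_distrib]
    omega
  refine not_subsingleton_iff_nontrivial.2 h2
    (hD.yonedaAlg_subsingleton P _ _ _ ?_)
  -- Equal ends: the output degree is at most 2 - k, negative since k ≥ 3. Different ends: it is at
  -- most (n - 1) + 2 - k ≤ 0, and degree 0 is also excluded between distinct simples.
  by_cases hl : o (Fin.last k) = o 0
  · rw [hl] at h4
    left
    omega
  · have := (o (Fin.last k)).2
    have := (o 0).2
    omega

/-! ### Čech cohomology of line bundles, one character at a time -/

namespace ToricFanoSurface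

variable {r : ℕ} [NeZero r]

/-- The numbers `⟨u, v i⟩ + d i`: the character `u` is a section of `𝒪(d)` over a cone if they are
nonnegative for the rays `i` of the cone. -/
def height (X : ToricFanoSurface r) (d : Divisor r) (u : ℤ × ℤ) (i : Fin r) : ℤ :=
  latticePairing u (X.v i) + d i

lemma three_le (X : ToricFanoSurface r) : 3 ≤ r := by
  have h0 := X.origin_interior 0
  by_contra! h
  interval_cases r
  · exact NeZero.ne 0 rfl
  · simp [latticeDet, mul_comm] at h0
  · have h1 := X.origin_interior 1
    simp only [zero_add, latticeDet] at h0 h1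
    rw [show (1 + 1 : Fin 2) = 0 from rfl] at h1
    linarith

variable {X : ToricFanoSurface r}

omit [NeZero r] in
lemma cechDiff_apply {p : ℕ} (f : (Fin (p + 1) → Fin r) → CharRing) (β : Fin (p + 2) → Fin r) :
    cechDiff r p f β = ∑ q : Fin (p + 2), ((-1 : ℤ) ^ (q : ℕ)) • f (fun s => β (q.succAbove s)) := by
  simp [cechDiff]

lemma exists_section_of_subsingleton {d : Divisor r}
    (h : Subsingleton (X.lineBundleCohomology d 0)) (u : ℤ × ℤ) : ∃ i, X.height d u i < 0 := by
  classical
  by_contra! hu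
  have h1 : (fun _ => AddMonoidAlgebra.single u 1 : (Fin 1 → Fin r) → CharRing) ∈
      X.cechCocycles d 0 := by
    refine ⟨fun α _ w hw i _ => ?_, ?_⟩
    · by_cases huw : u = w
      · exact huw ▸ hu i
      · simp [huw] at hw
    · change cechDiff r 0 _ = 0
      funext α
      simp [cechDiff, Fin.sum_univ_two]
  have h2 := (Submodule.eq_top_iff'.1 (Submodule.Quotient.subsingleton_iff.1 h)) ⟨_, h1⟩
  have h3 : (fun _ => AddMonoidAlgebra.single u 1 : (Fin 1 → Fin r) → CharRing) = 0 := by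
    simpa [Submodule.submoduleOf, cechCoboundaries] using h2
  have h4 := congrArg (fun f => f.coeff u) (congrFun h3 fun _ => 0)
  simp at h4

/-- The Čech complex is graded by characters. This is exactness of its part of weight `u`, whose
cochains are scalar functions supported where `u` is regular. -/
lemma exists_primitive_of_subsingleton {d : Divisor r} {p : ℕ}
    (h : Subsingleton (X.lineBundleCohomology d (p + 1))) (u : ℤ × ℤ)
    (φ : (Fin (p + 2) → Fin r) → ℂ)
    (hsupp : ∀ α, φ α ≠ 0 → ∀ i ∈ commonRays α, 0 ≤ X.height d u i)
    (hφ : ∀ β : Fin (p + 3) → Fin r,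
      ∑ q : Fin (p + 3), (-1) ^ (q : ℕ) * φ (fun s => β (q.succAbove s)) = 0) :
    ∃ g : (Fin (p + 1) → Fin r) → ℂ,
      (∀ α, g α ≠ 0 → ∀ i ∈ commonRays α, 0 ≤ X.height d u i) ∧
      ∀ β : Fin (p + 2) → Fin r,
        ∑ q : Fin (p + 2), (-1) ^ (q : ℕ) * g (fun s => β (q.succAbove s)) = φ β := by
  classical
  have h1 : (fun α => AddMonoidAlgebra.single u (φ α) : (Fin (p + 2) → Fin r) → CharRing) ∈
      X.cechCocycles d (p + 1) := by
    refine ⟨fun α _ w hw i hi => ?_, ?_⟩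
    · by_cases huw : u = w
      · subst huw
        exact hsupp α (by simpa using hw) i hi
      · simp [huw] at hw
    · change cechDiff r (p + 1) _ = 0
      funext β
      rw [cechDiff_apply]
      have := congrArg (AddMonoidAlgebra.singleAddHom u) (hφ β)
      rw [map_sum, map_zero] at this
      rw [Pi.zero_apply, ← this]
      refine Finset.sum_congr rfl fun q _ => ?_
      change (-1 : ℤ) ^ (q : ℕ) • AddMonoidAlgebra.singleAddHom u _ = _
      rw [← map_zsmul, zsmul_eq_mul]
      push_cast
      rfl
  obtain ⟨g, hg, hgφ⟩ : (fun α => AddMonoidAlgebra.single u (φ α)) ∈ X.cechCoboundaries d (p + 1) :=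
    (Submodule.eq_top_iff'.1 (Submodule.Quotient.subsingleton_iff.1 h)) ⟨_, h1⟩
  refine ⟨fun α => (g α).coeff u, fun α hα i hi => hg α trivial u hα i hi, fun β => ?_⟩
  have := congrArg (fun f => f.coeff u) (congrFun hgφ β)
  simp only [cechDiff_apply, AddMonoidAlgebra.coeff_sum, Finsupp.finsetSum_apply,
    AddMonoidAlgebra.coeff_single, Finsupp.single_eq_same] at this
  rw [← this]
  refine Finset.sum_congr rfl fun q _ => ?_
  rw [AddMonoidAlgebra.coeff_smul_apply, zsmul_eq_mul]
  push_cast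
  rfl

lemma mem_commonRays {p : ℕ} {α : Fin (p + 1) → Fin r} {c : Fin r} :
    c ∈ commonRays α ↔ ∀ q, α q = c ∨ α q = c - 1 := by
  simp only [commonRays, maxCone, Finset.mem_filter_univ, Finset.mem_insert,
    Finset.mem_singleton, eq_sub_iff_add_eq]
  exact forall_congr' fun q => or_congr eq_comm eq_comm

lemma val_sub_one (c : Fin r) : (c - 1).val = if c.val = 0 then r - 1 else c.val - 1 := by
  obtain ⟨m, rfl⟩ := Nat.exists_eq_succ_of_ne_zero (NeZero.ne r)
  have := Fin.coe_sub_one c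
  rw [this]
  simp only [Fin.ext_iff, Fin.val_zero]
  rfl

/-- Two descents separate the nonnegative rays into at least two runs, which produces a class in H¹:
the coboundary of a function on the cones that is constant across negative rays but differs at the
cones `i` and `j`. -/
lemma descent_unique_of_subsingleton {d : Divisor r}
    (h : Subsingleton (X.lineBundleCohomology d 1)) (u : ℤ × ℤ) {i j : Fin r}
    (hi : 0 ≤ X.height d u i) (hi' : X.height d u (i + 1) < 0)
    (hj : 0 ≤ X.height d u j) (hj' : X.height d u (j + 1) < 0) : i = j := by
  classical
  wlog hij : i < j generalizing i j
  · rcases (not_lt.1 hij).eq_or_lt with h | h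
    · exact h.symm
    · exact (this hj hj' hi hi' h).symm
  -- `f` jumps only across the rays `i` and `j`, both nonnegative, so its coboundary is admissible
  -- although `f` need not be. An admissible primitive vanishes on the cones `i` and `j`, which
  -- contain the negative rays `i + 1` and `j + 1`, whereas f j - f i = -1.
  let f : Fin r → ℂ := fun k => if i ≤ k ∧ k < j then 1 else 0
  have hf : ∀ c, X.height d u c < 0 → f c = f (c - 1) := by
    intro c hc
    have hci : c ≠ i := by rintro rfl; omega
    have hcj : c ≠ j := by rintro rfl; omega
    have hcv : (c - 1 : Fin r).val = if c.val = 0 then r - 1 else c.val - 1 :=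
      val_sub_one c
    simp only [f, Fin.le_def, Fin.lt_def, hcv]
    rw [Ne, Fin.ext_iff] at hci hcj
    split_ifs <;> first | rfl | (exfalso; omega)
  obtain ⟨g, hg, hgf⟩ := exists_primitive_of_subsingleton (p := 0) h u (fun α => f (α 1) - f (α 0))
    (by
      intro α hα c hc
      by_contra! hneg
      have h1 := mem_commonRays.1 hc
      apply hα
      rcases h1 0 with h0 | h0 <;> rcases h1 1 with h1 | h1 <;> simp [h0, h1, hf c hneg])
    (by
      intro β
      simp [Fin.sum_univ_succ, Fin.succAbove])
  have hgi : g (fun _ => i) = 0 := by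
    by_contra hne
    exact absurd (hg _ hne (i + 1) (mem_commonRays.2 fun _ => Or.inr (by simp))) (by omega)
  have hgj : g (fun _ => j) = 0 := by
    by_contra hne
    exact absurd (hg _ hne (j + 1) (mem_commonRays.2 fun _ => Or.inr (by simp))) (by omega)
  have h0 : (fun s : Fin 1 => ![i, j] (Fin.succAbove 0 s)) = fun _ => j := by
    funext s
    fin_cases s
    rfl
  have h1 : (fun s : Fin 1 => ![i, j] (Fin.succAbove 1 s)) = fun _ => i := by
    funext s
    fin_cases s
    rfl
  have := hgf ![i, j]
  rw [Fin.sum_univ_two, h0, h1, hgi, hgj] at this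
  simp [f, hij] at this

/-- If every ray is negative, only tuples of cones without a common ray carry cochains, and a class
in H² detects the loop of cones around the origin. -/
lemma exists_nonneg_of_subsingleton {d : Divisor r}
    (h : Subsingleton (X.lineBundleCohomology d 2)) (u : ℤ × ℤ) : ∃ i, 0 ≤ X.height d u i := by
  classical
  by_contra! hneg
  have hr := X.three_le
  have hm : (-1 : Fin r).val = r - 1 := by simpa using val_sub_one (0 : Fin r)
  have h10 : (1 : Fin r).val = 1 := by
    rw [Fin.val_one', Nat.mod_eq_of_lt (by omega)]
  have hne : (-1 : Fin r) ≠ 0 := by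
    rw [Ne, Fin.ext_iff, hm, Fin.val_zero]
    omega
  have hne' : (-1 : Fin r) ≠ 1 := by
    rw [Ne, Fin.ext_iff, hm, h10]
    omega
  -- `t` is the antisymmetric 1-cochain with value 1 on the step from the last cone to cone 0. An
  -- admissible primitive `g` of its coboundary vanishes on adjacent cones, so the cocycle `t - g`
  -- is the coboundary of a function `f` whose increments around the cycle add up to 1 instead of 0.
  let t : Fin r → Fin r → ℂ := fun a b => (if a = -1 ∧ b = 0 then 1 else 0) -
    if a = 0 ∧ b = -1 then 1 else 0
  have hself : ∀ a, t a a = 0 := by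
    intro a
    have h1 : ¬ (a = -1 ∧ a = 0) := fun h => hne (h.1.symm.trans h.2)
    have h2 : ¬ (a = 0 ∧ a = -1) := fun h => h1 h.symm
    simp [t, h1, h2]
  have hanti : ∀ a b, t a b = - t b a := by
    intro a b
    simp only [t, and_comm]
    ring
  have hstep : ∀ c, t (c - 1) c = if c = 0 then 1 else 0 := by
    intro c
    have h2 : ¬ (c - 1 = 0 ∧ c = -1) := by
      rintro ⟨h1, rfl⟩
      exact hne' (sub_eq_zero.1 h1)
    simp [t, h2]
  obtain ⟨g, hg, hgf⟩ := exists_primitive_of_subsingleton (p := 1) h u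
    (fun α => t (α 1) (α 2) - t (α 0) (α 2) + t (α 0) (α 1))
    (by
      intro α hα c hc
      exfalso
      have h1 := mem_commonRays.1 hc
      apply hα
      rcases h1 0 with h0 | h0 <;> rcases h1 1 with h1 | h1 <;> rcases mem_commonRays.1 hc 2 with
        h2 | h2 <;> simp only [h0, h1, h2, hself, hanti c (c - 1)] <;> ring)
    (by
      intro β
      simp [Fin.sum_univ_succ, Fin.succAbove]
      ring)
  have hcoc : ∀ a b c, g ![b, c] - g ![a, c] + g ![a, b] = t b c - t a c + t a b := by
    intro a b c
    have h0 : (fun s : Fin 2 => ![a, b, c] (Fin.succAbove 0 s)) = ![b, c] := by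
      funext s
      fin_cases s <;> rfl
    have h1 : (fun s : Fin 2 => ![a, b, c] (Fin.succAbove 1 s)) = ![a, c] := by
      funext s
      fin_cases s <;> rfl
    have h2 : (fun s : Fin 2 => ![a, b, c] (Fin.succAbove 2 s)) = ![a, b] := by
      funext s
      fin_cases s <;> rfl
    have := hgf ![a, b, c]
    rw [Fin.sum_univ_three, h0, h1, h2] at this
    simpa [sub_eq_add_neg] using this
  have hzero : ∀ c : Fin r, g ![c - 1, c] = 0 := by
    intro c
    by_contra hne
    refine absurd (hg _ hne c (mem_commonRays.2 fun q => ?_)) (not_le.2 (hneg c))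
    fin_cases q
    · exact Or.inr rfl
    · exact Or.inl rfl
  let f : Fin r → ℂ := fun b => t 0 b - g ![0, b]
  have hf : ∀ c, f c - f (c - 1) = if c = 0 then 1 else 0 := by
    intro c
    have := hcoc 0 (c - 1) c
    rw [hzero, hstep] at this
    simp only [f]
    linear_combination this
  have h1 : ∑ c, (f c - f (c - 1)) = 1 := by simp [hf]
  have h2 : ∑ c, f (c - 1) = ∑ c, f c := Equiv.sum_comp (Equiv.subRight (1 : Fin r)) f
  rw [Finset.sum_sub_distrib, h2, sub_self] at h1
  exact zero_ne_one h1

/-! ### Euler characteristics of line bundles -/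

lemma forall_of_step {p : Fin r → Prop} (hp : ∀ i, p i → p (i + 1)) {i : Fin r} (hi : p i)
    (j : Fin r) : p j := by
  have h : ∀ m : ℕ, p (i + Fin.ofNat r m) := by
    intro m
    induction m with
    | zero => simpa using hi
    | succ m ih =>
      have : i + Fin.ofNat r (m + 1) = i + Fin.ofNat r m + 1 := by
        refine Fin.ext ?_
        simp [Fin.val_add, Fin.ofNat, Nat.add_assoc]
      rw [this]
      exact hp _ ih
  have h2 := h (j - i).val
  rwa [show i + Fin.ofNat r (j - i).val = j from ?_] at h2
  rw [show Fin.ofNat r (j - i).val = j - i from by simp]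
  exact add_sub_cancel i j

lemma exists_descent {a : Fin r → ℤ} (h₁ : ∃ i, a i < 0) (h₂ : ∃ i, 0 ≤ a i) :
    ∃ i, 0 ≤ a i ∧ a (i + 1) < 0 := by
  by_contra! h
  obtain ⟨i, hi⟩ := h₂
  obtain ⟨j, hj⟩ := h₁
  exact absurd (forall_of_step (p := fun i => 0 ≤ a i) h hi j) (not_le.2 hj)

/-- The Euler characteristic of the part of the cohomology of a line bundle on which the torus acts
by a character, in terms of the heights `a` of the character. -/
def charEuler (a : Fin r → ℤ) : ℤ := 1 - ∑ i, if 0 ≤ a i ∧ a (i + 1) < 0 then 1 else 0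

lemma charEuler_eq_zero {a : Fin r → ℤ} (h₁ : ∃ i, a i < 0) (h₂ : ∃ i, 0 ≤ a i)
    (h : ∀ i j, 0 ≤ a i → a (i + 1) < 0 → 0 ≤ a j → a (j + 1) < 0 → i = j) : charEuler a = 0 := by
  obtain ⟨i, hi, hi'⟩ := exists_descent h₁ h₂
  rw [charEuler, Finset.sum_eq_single i, if_pos ⟨hi, hi'⟩, sub_self]
  · intro j _ hj
    rw [if_neg]
    exact fun hj' => hj (h j i hj'.1 hj'.2 hi hi')
  · simp

/-- The indicator function of the nonnegative integers. -/
def nonnegInd (x : ℤ) : ℤ := if 0 ≤ x then 1 else 0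

/-- This form has terms in one coordinate or in two adjacent ones only, which is what the difference
equations exploit. -/
lemma charEuler_eq (a : Fin r → ℤ) : charEuler a =
    1 - ∑ i, nonnegInd (a i) + ∑ i, nonnegInd (a i) * nonnegInd (a (i + 1)) := by
  rw [charEuler, sub_add, ← Finset.sum_sub_distrib]
  refine congrArg _ (Finset.sum_congr rfl fun i _ => ?_)
  simp only [nonnegInd]
  split_ifs <;> first | rfl | omega

variable (X : ToricFanoSurface r)

/-- At a descent the edge crosses the line u = 0, at a position along it proportional to det(vᵢ,
vᵢ₊₁) / (hᵢ - hᵢ₊₁), where hᵢ = ⟨u, vᵢ⟩. By convexity the crossing of edge `j` lies strictly inside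
edge `i`, so its position is strictly smaller; exchanging `i` and `j` gives a contradiction. -/
lemma descent_unique (u : ℤ × ℤ) {i j : Fin r}
    (hi : 0 ≤ latticePairing u (X.v i)) (hi' : latticePairing u (X.v (i + 1)) < 0)
    (hj : 0 ≤ latticePairing u (X.v j)) (hj' : latticePairing u (X.v (j + 1)) < 0) : i = j := by
  by_contra hij
  have key : ∀ i j : Fin r, 0 ≤ latticePairing u (X.v i) → latticePairing u (X.v (i + 1)) < 0 →
      0 ≤ latticePairing u (X.v j) → latticePairing u (X.v (j + 1)) < 0 → i ≠ j →
      0 < (latticePairing u (X.v j) - latticePairing u (X.v (j + 1))) *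
          latticeDet (X.v i) (X.v (i + 1)) -
        (latticePairing u (X.v i) - latticePairing u (X.v (i + 1))) *
          latticeDet (X.v j) (X.v (j + 1)) := by
    intro i j hi hi' hj hj' hij
    have hji : j ≠ i + 1 := by
      rintro rfl
      omega
    have h1 := X.convex i j (Ne.symm hij) hji
    have h2 : 0 ≤ latticeDet (X.v (i + 1) - X.v i) (X.v (j + 1) - X.v i) := by
      by_cases h : j + 1 = i
      · rw [h]
        simp [latticeDet]
      by_cases h' : j + 1 = i + 1
      · exact absurd (add_right_cancel h').symm hij
      exact (X.convex i (j + 1) h h').le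
    have h3 := mul_nonneg hj h2
    have h4 := mul_pos_of_neg_of_neg hj' (neg_lt_zero.2 h1)
    refine lt_of_lt_of_eq (add_pos_of_nonneg_of_pos h3 h4) ?_
    simp only [latticePairing, latticeDet, Prod.fst_sub, Prod.snd_sub]
    ring
  have h1 := key i j hi hi' hj hj' hij
  have h2 := key j i hj hj' hi hi' (Ne.symm hij)
  linarith

/-- With `g` the pairing with `u` rotated by a right angle, positivity of the determinants makes the
slopes g/h strictly increase from each vertex to the next, as long as `h` keeps one strict sign.
This is impossible around a cycle. -/
lemma exists_pos_neg {u : ℤ × ℤ} (hu : u ≠ 0) :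
    (∃ i, latticePairing u (X.v i) < 0) ∧ ∃ i, 0 ≤ latticePairing u (X.v i) := by
  let h : Fin r → ℤ := fun i => latticePairing u (X.v i)
  let g : Fin r → ℤ := fun i => u.1 * (X.v i).2 - u.2 * (X.v i).1
  have hN : 0 < u.1 * u.1 + u.2 * u.2 := by
    rcases not_and_or.1 (fun h : u.1 = 0 ∧ u.2 = 0 => hu (Prod.ext h.1 h.2)) with h | h
    · have := mul_self_pos.2 h
      have := mul_self_nonneg u.2
      omega
    · have := mul_self_pos.2 h
      have := mul_self_nonneg u.1
      omega
  have hdet : ∀ i, 0 < h i * g (i + 1) - g i * h (i + 1) := by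
    intro i
    refine lt_of_lt_of_eq (mul_pos hN (X.origin_interior i)) ?_
    simp only [h, g, latticePairing, latticeDet]
    ring
  have hslope : ¬ ∀ i, 0 < h i * h (i + 1) := by
    intro hpos
    have hlt : ∀ i, (g i / h i : ℚ) < g (i + 1) / h (i + 1) := by
      intro i
      have h0 : (0 : ℚ) < h i * h (i + 1) := by exact_mod_cast hpos i
      have h1 : (h i : ℚ) ≠ 0 := left_ne_zero_of_mul h0.ne'
      have h2 : (h (i + 1) : ℚ) ≠ 0 := right_ne_zero_of_mul h0.ne'
      have h3 : (0 : ℚ) < h i * g (i + 1) - g i * h (i + 1) := by exact_mod_cast hdet i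
      rw [← sub_pos, div_sub_div _ _ h2 h1]
      refine div_pos ?_ (by rwa [mul_comm])
      linarith
    obtain ⟨i, hi⟩ := Finite.exists_max fun i => (g i / h i : ℚ)
    exact absurd (hi (i + 1)) (not_le.2 (hlt i))
  constructor
  · by_contra! hn
    have hne : ∀ i, 0 < h i := by
      intro i
      refine lt_of_le_of_ne (hn i) fun h0 => ?_
      have h1 := hdet i
      have h2 := hdet (i - 1)
      rw [sub_add_cancel] at h2
      rw [← h0, zero_mul, zero_sub] at h1
      rw [← h0, mul_zero, sub_zero] at h2
      have h3 : 0 < g i := by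
        by_contra hc
        exact absurd h2
          (not_lt.2 (mul_nonpos_of_nonneg_of_nonpos (hn (i - 1)) (not_lt.1 hc)))
      have h4 := mul_nonneg h3.le (hn (i + 1))
      change 0 ≤ g i * h (i + 1) at h4
      linarith
    exact hslope fun i => mul_pos (hne i) (hne _)
  · by_contra! hn
    exact hslope fun i => mul_pos_of_neg_of_neg (hn i) (hn _)

lemma charEuler_pairing {u : ℤ × ℤ} (hu : u ≠ 0) :
    charEuler (fun i => latticePairing u (X.v i)) = 0 :=
  charEuler_eq_zero (X.exists_pos_neg hu).1 (X.exists_pos_neg hu).2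
    fun _ _ h1 h2 h3 h4 => X.descent_unique u h1 h2 h3 h4

omit [NeZero r] in
lemma eq_of_step_invariant {α : Type*} (H : Divisor r → α) (J : Set (Fin r))
    (hH : ∀ i ∈ J, ∀ d, H (d + Pi.single i 1) = H d) {d d' : Divisor r}
    (h : ∀ i, i ∉ J → d i = d' i) :
    H d = H d' := by
  have h1 : ∀ i ∈ J, ∀ (m : ℤ) (d), H (d + Pi.single i m) = H d := by
    intro i hi m
    induction m with
    | zero => simp
    | succ m ih =>
      intro d
      rw [Pi.single_add, ← add_assoc, hH i hi, ih]
    | pred m ih =>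
      intro d
      rw [← ih d, ← hH i hi, add_assoc, ← Pi.single_add, sub_add_cancel]
  have h2 : ∀ s : Finset (Fin r), H (d + ∑ i ∈ s, Pi.single i (d' i - d i)) = H d := by
    intro s
    induction s using Finset.induction_on with
    | empty => simp
    | insert i s hi ih =>
      rw [Finset.sum_insert hi, add_comm (Pi.single i _), ← add_assoc]
      by_cases hiJ : i ∈ J
      · rw [h1 i hiJ, ih]
      · rw [h i hiJ, sub_self, Pi.single_zero, add_zero, ih]
  rw [← h2 Finset.univ]
  congr 1
  rw [Finset.univ_sum_single (fun i => d' i - d i)]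
  ext i
  simp

/-- The divisor of a character. -/
def principal (u : ℤ × ℤ) : Divisor r := fun i => latticePairing u (X.v i)

lemma add_one_ne (X : ToricFanoSurface r) (i : Fin r) : i + 1 ≠ i := by
  intro h
  have := X.origin_interior i
  rw [h] at this
  simp [latticeDet, mul_comm] at this

lemma sub_one_ne (X : ToricFanoSurface r) (i : Fin r) : i - 1 ≠ i := by
  intro h
  exact X.add_one_ne (i - 1) (by rw [sub_add_cancel, h])

/-- The right side is nonzero only if `a i = -1` and both neighbours have the same sign. -/
lemma charEuler_add_single (X : ToricFanoSurface r) (a : Divisor r) (i : Fin r) :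
    charEuler (a + Pi.single i 1) - charEuler a =
      (nonnegInd (a i + 1) - nonnegInd (a i)) *
        (nonnegInd (a (i - 1)) + nonnegInd (a (i + 1)) - 1) := by
  set δ := nonnegInd (a i + 1) - nonnegInd (a i)
  have hb : ∀ m, nonnegInd ((a + Pi.single i 1 : Divisor r) m) =
      nonnegInd (a m) + if m = i then δ else 0 := by
    intro m
    by_cases hm : m = i
    · subst hm
      simp [δ]
    · simp [hm]
  have hprod : ∀ m, nonnegInd ((a + Pi.single i 1 : Divisor r) m) *
        nonnegInd ((a + Pi.single i 1 : Divisor r) (m + 1)) =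
      nonnegInd (a m) * nonnegInd (a (m + 1)) + (if m = i then δ * nonnegInd (a (i + 1)) else 0) +
        if m = i - 1 then δ * nonnegInd (a (i - 1)) else 0 := by
    intro m
    rw [hb, hb]
    by_cases hm : m = i
    · subst hm
      simp [X.add_one_ne m, (X.sub_one_ne m).symm]
      ring
    · by_cases hm' : m = i - 1
      · subst hm'
        simp [X.sub_one_ne i]
        ring
      · have : m + 1 ≠ i := fun h => hm' (by rw [← h, add_sub_cancel_right])
        simp [hm, hm', this]
  rw [charEuler_eq, charEuler_eq]
  simp only [hprod]
  simp only [hb, Finset.sum_add_distrib, Finset.sum_ite_eq', Finset.mem_univ, if_true]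
  ring

lemma finite_setOf_pairing (i : Fin r) (c : ℤ) (l m : ℤ) :
    {u : ℤ × ℤ | latticePairing u (X.v i) = c ∧ l ≤ latticePairing u (X.v (i + 1)) ∧
      latticePairing u (X.v (i + 1)) ≤ m}.Finite := by
  refine Set.Finite.of_finite_image (f := fun u =>
    (latticePairing u (X.v i), latticePairing u (X.v (i + 1))))
    (((Set.finite_singleton c).prod (Set.finite_Icc l m)).subset ?_) ?_
  · rintro _ ⟨u, ⟨h1, h2, h3⟩, rfl⟩
    exact ⟨h1, h2, h3⟩
  · intro u _ w _ h
    obtain ⟨h1, h2⟩ := Prod.ext_iff.1 h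
    simp only [latticePairing] at h1 h2
    have hd := (X.origin_interior i).ne'
    have e1 : (u.1 - w.1) * latticeDet (X.v i) (X.v (i + 1)) = 0 := by
      simp only [latticeDet]
      linear_combination (X.v (i + 1)).2 * h1 - (X.v i).2 * h2
    have e2 : (u.2 - w.2) * latticeDet (X.v i) (X.v (i + 1)) = 0 := by
      simp only [latticeDet]
      linear_combination (X.v i).1 * h2 - (X.v (i + 1)).1 * h1
    exact Prod.ext (sub_eq_zero.1 ((mul_eq_zero.1 e1).resolve_right hd))
      (sub_eq_zero.1 ((mul_eq_zero.1 e2).resolve_right hd))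

/-- A contributing `u` lies on the line ⟨u, vᵢ⟩ = -1 - dᵢ, and the heights at the two neighbours
have the same sign. A positive combination of vᵢ₋₁ and vᵢ₊₁ is a multiple of vᵢ, so the
corresponding combination of pairings is constant on that line and both are bounded. -/
lemma finite_charEuler_add_single (d : Divisor r) (i : Fin r) :
    {u : ℤ × ℤ | charEuler (X.principal u + d + Pi.single i 1) -
      charEuler (X.principal u + d) ≠ 0}.Finite := by
  have hA := X.origin_interior i
  have hB := X.origin_interior (i - 1)
  rw [sub_add_cancel] at hB
  set A := latticeDet (X.v i) (X.v (i + 1))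
  set B := latticeDet (X.v (i - 1)) (X.v i)
  set C := latticeDet (X.v (i - 1)) (X.v (i + 1))
  have hrel : ∀ u, A * latticePairing u (X.v (i - 1)) + B * latticePairing u (X.v (i + 1)) =
      C * latticePairing u (X.v i) := by
    intro u
    simp only [A, B, C, latticeDet, latticePairing]
    ring
  set K := C * (-1 - d i) + A * d (i - 1)
  refine ((X.finite_setOf_pairing i (-1 - d i) (-d (i + 1)) |K|).union
    (X.finite_setOf_pairing i (-1 - d i) (-|K + A|) (-d (i + 1)))).subset ?_
  intro u hu
  rw [Set.mem_ofPred_eq, X.charEuler_add_single] at hu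
  have h1 := left_ne_zero_of_mul hu
  have h2 := right_ne_zero_of_mul hu
  have h0 : latticePairing u (X.v i) = -1 - d i := by
    by_contra hne
    apply h1
    simp only [principal, Pi.add_apply, nonnegInd]
    split_ifs <;> first | rfl | omega
  have hr := hrel u
  rw [h0] at hr
  simp only [principal, Pi.add_apply, nonnegInd] at h2
  by_cases hx : 0 ≤ latticePairing u (X.v (i - 1)) + d (i - 1)
  · have hz : 0 ≤ latticePairing u (X.v (i + 1)) + d (i + 1) := by
      by_contra hz
      simp [hx, hz] at h2
    refine Or.inl ⟨h0, by omega, ?_⟩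
    have h3 := mul_nonneg hA.le hx
    have h4 : B * latticePairing u (X.v (i + 1)) ≤ |K| :=
      le_trans (by simp only [K]; linarith) (le_abs_self K)
    by_contra! h5
    have h6 : 0 ≤ |K| := abs_nonneg K
    nlinarith
  · have hz : ¬ 0 ≤ latticePairing u (X.v (i + 1)) + d (i + 1) := by
      intro hz
      simp [hx, hz] at h2
    refine Or.inr ⟨h0, ?_, by omega⟩
    have h3 : 0 ≤ A * (-1 - latticePairing u (X.v (i - 1)) - d (i - 1)) :=
      mul_nonneg hA.le (by omega)
    have h4 : -|K + A| ≤ B * latticePairing u (X.v (i + 1)) :=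
      le_trans (neg_abs_le (K + A)) (by simp only [K]; linarith)
    by_contra! h5
    have h6 : 0 ≤ |K + A| := abs_nonneg _
    nlinarith

/-- Finiteness is unchanged when one coefficient of `d` moves by one, and for d = 0 only the trivial
character contributes. The step principle is applied to a proposition-valued `H`. -/
lemma finite_charEuler (d : Divisor r) :
    {u : ℤ × ℤ | charEuler (X.principal u + d) ≠ 0}.Finite := by
  let H : Divisor r → Prop := fun d => {u : ℤ × ℤ | charEuler (X.principal u + d) ≠ 0}.Finite
  have h0 : H 0 := by
    refine (Set.finite_singleton (0 : ℤ × ℤ)).subset fun u hu => ?_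
    by_contra hne
    refine hu ?_
    rw [add_zero]
    exact X.charEuler_pairing hne
  have h : H d = H 0 := by
    refine eq_of_step_invariant H Set.univ (fun i _ d => propext ⟨fun h => ?_, fun h => ?_⟩)
      (fun i hi => absurd (Set.mem_univ i) hi)
    · refine (h.union (X.finite_charEuler_add_single d i)).subset fun u hu => ?_
      by_contra hn
      simp only [Set.mem_union, Set.mem_ofPred_eq, not_or, not_not] at hn
      rw [add_assoc] at hn
      obtain ⟨h1, h2⟩ := hn
      exact hu (by linarith)
    · refine (h.union (X.finite_charEuler_add_single d i)).subset fun u hu => ?_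
      by_contra hn
      simp only [Set.mem_union, Set.mem_ofPred_eq, not_or, not_not] at hn
      rw [add_assoc] at hn
      obtain ⟨h1, h2⟩ := hn
      exact hu (by linarith)
  exact h.mpr h0

/-- The Euler characteristic of the cohomology of `𝒪(d)`. -/
def lineBundleEuler (d : Divisor r) : ℤ := ∑ᶠ u, charEuler (X.principal u + d)

lemma lineBundleEuler_zero : X.lineBundleEuler 0 = 1 := by
  rw [lineBundleEuler, finsum_eq_single _ 0]
  · simp [charEuler, principal, latticePairing]
  · intro u hu
    rw [add_zero]
    exact X.charEuler_pairing hu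

lemma lineBundleEuler_principal_add (w : ℤ × ℤ) (d : Divisor r) :
    X.lineBundleEuler (X.principal w + d) = X.lineBundleEuler d := by
  have h : ∀ u, X.principal u + (X.principal w + d) = X.principal (u + w) + d := by
    intro u
    funext i
    simp only [principal, latticePairing, Pi.add_apply, Prod.fst_add, Prod.snd_add]
    ring
  simp only [lineBundleEuler, h]
  exact finsum_comp_equiv (Equiv.addRight w) (f := fun u => charEuler (X.principal u + d))

variable {X} in
lemma lineBundleEuler_eq_zero {d : Divisor r}
    (h : ∀ p, Subsingleton (X.lineBundleCohomology d p)) : X.lineBundleEuler d = 0 := by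
  refine finsum_eq_zero_of_forall_eq_zero fun u => ?_
  exact charEuler_eq_zero (exists_section_of_subsingleton (h 0) u)
    (exists_nonneg_of_subsingleton (h 2) u)
    fun i j h1 h2 h3 h4 => descent_unique_of_subsingleton (h 1) u h1 h2 h3 h4

/-! ### Difference equations dual to the relations of K₀ -/

/-- The difference operator in the direction of the `i`-th coordinate. -/
def diffOp (i : Fin r) : (Divisor r → ℚ) →ₗ[ℚ] (Divisor r → ℚ) where
  toFun G d := G (d + Pi.single i 1) - G d
  map_add' G G' := by
    funext d
    simp only [Pi.add_apply]
    ring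
  map_smul' c G := by
    funext d
    simp only [Pi.smul_apply, smul_eq_mul, RingHom.id_apply]
    ring

/-- Translation by a divisor. -/
def transOp (e : Divisor r) : (Divisor r → ℚ) →ₗ[ℚ] (Divisor r → ℚ) :=
  LinearMap.funLeft ℚ ℚ fun d => e + d

omit [NeZero r] in
lemma diffOp_comm (i j : Fin r) (G : Divisor r → ℚ) :
    diffOp i (diffOp j G) = diffOp j (diffOp i G) := by
  funext d
  change G (d + Pi.single i 1 + Pi.single j 1) - G (d + Pi.single i 1) -
    (G (d + Pi.single j 1) - G d) = G (d + Pi.single j 1 + Pi.single i 1) -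
      G (d + Pi.single j 1) - (G (d + Pi.single i 1) - G d)
  rw [add_right_comm d (Pi.single j 1)]
  ring

omit [NeZero r] in
lemma diffOp_transOp (i : Fin r) (e : Divisor r) (G : Divisor r → ℚ) :
    diffOp i (transOp e G) = transOp e (diffOp i G) := by
  funext d
  change G (e + (d + Pi.single i 1)) - G (e + d) = G (e + d + Pi.single i 1) - G (e + d)
  rw [add_assoc]

omit [NeZero r] in
lemma transOp_comm (e e' : Divisor r) (G : Divisor r → ℚ) :
    transOp e (transOp e' G) = transOp e' (transOp e G) := by
  funext d
  change G (e' + (e + d)) = G (e + (e' + d))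
  rw [add_left_comm]

omit [NeZero r] in
lemma diffOp_eq_zero {i : Fin r} {G : Divisor r → ℚ}
    (h : ∀ d d', (∀ j, j ≠ i → d j = d' j) → G d = G d') : diffOp i G = 0 := by
  funext d
  refine sub_eq_zero.2 (h _ _ fun j hj => ?_)
  simp [hj]

/-- The functions on the group of divisors that satisfy the relations of the Grothendieck group of
`X`: invariance under principal divisors and the Stanley–Reisner relations. -/
def grothendieckDual : Submodule ℚ (Divisor r → ℚ) where
  carrier := {G | (∀ w, transOp (X.principal w) G = G) ∧
    (∀ j k, j ≠ k → j ≠ k + 1 → k ≠ j + 1 → diffOp j (diffOp k G) = 0) ∧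
    ∀ j, j ≠ 0 → j ≠ -1 → diffOp j (diffOp 0 (diffOp (-1) G)) = 0}
  add_mem' := fun ⟨h1, h2, h3⟩ ⟨h1', h2', h3'⟩ =>
    ⟨fun w => by rw [map_add, h1, h1'],
      fun j k a b c => by rw [map_add, map_add, h2 j k a b c, h2' j k a b c, add_zero],
      fun j a b => by rw [map_add, map_add, map_add, h3 j a b, h3' j a b, add_zero]⟩
  zero_mem' := ⟨fun w => map_zero _, fun _ _ _ _ _ => by rw [map_zero, map_zero],
    fun _ _ _ => by rw [map_zero, map_zero, map_zero]⟩
  smul_mem' := fun c G ⟨h1, h2, h3⟩ =>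
    ⟨fun w => by rw [map_smul, h1],
      fun j k a b c => by rw [map_smul, map_smul, h2 j k a b c, smul_zero],
      fun j a b => by rw [map_smul, map_smul, map_smul, h3 j a b, smul_zero]⟩

variable {X} in
lemma transOp_mem_grothendieckDual {G : Divisor r → ℚ} (hG : G ∈ X.grothendieckDual)
    (e : Divisor r) : transOp e G ∈ X.grothendieckDual := by
  obtain ⟨h1, h2, h3⟩ := hG
  refine ⟨fun w => by rw [transOp_comm, h1], fun j k a b c => ?_, fun j a b => ?_⟩
  · rw [diffOp_transOp, diffOp_transOp, h2 j k a b c, map_zero]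
  · rw [diffOp_transOp, diffOp_transOp, diffOp_transOp, h3 j a b, map_zero]

/-- The sum of a function over the classes of principal divisors. -/
def orbitSum (E : Divisor r → ℚ) : Divisor r → ℚ := fun d => ∑ᶠ u, E (X.principal u + d)

/-- Finiteness of the support on classes of principal divisors. -/
def OrbitFinite (E : Divisor r → ℚ) : Prop :=
  ∀ d, (Function.support fun u => E (X.principal u + d)).Finite

variable {X} in
lemma OrbitFinite.diffOp {E : Divisor r → ℚ} (hE : X.OrbitFinite E) (i : Fin r) :
    X.OrbitFinite (diffOp i E) := by
  intro d
  refine ((hE (d + Pi.single i 1)).union (hE d)).subset fun u hu => ?_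
  by_contra hn
  simp only [Set.mem_union, Function.mem_support, not_or, not_not] at hn
  refine hu ?_
  change E (X.principal u + d + Pi.single i 1) - E (X.principal u + d) = 0
  rw [add_assoc, hn.1, hn.2, sub_zero]

variable {X} in
lemma OrbitFinite.diffOp_orbitSum {E : Divisor r → ℚ} (hE : X.OrbitFinite E) (i : Fin r) :
    ToricFanoSurface.diffOp i (X.orbitSum E) = X.orbitSum (ToricFanoSurface.diffOp i E) := by
  funext d
  change X.orbitSum E (d + Pi.single i 1) - X.orbitSum E d = _
  rw [orbitSum, orbitSum, ← finsum_sub_distrib (hE _) (hE _)]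
  refine finsum_congr fun u => ?_
  rw [← add_assoc]
  rfl

lemma orbitSum_zero : X.orbitSum 0 = 0 := by
  funext d
  simp [orbitSum]

/-- The function `charEuler` with rational values. -/
def charEulerQ : Divisor r → ℚ := fun a => charEuler a

lemma charEulerQ_eq : (charEulerQ : Divisor r → ℚ) =
    (fun _ => 1) - ∑ m : Fin r, (fun a => (nonnegInd (a m) : ℚ)) +
      ∑ m : Fin r, fun a => (nonnegInd (a m) * nonnegInd (a (m + 1)) : ℚ) := by
  funext a
  simp [charEulerQ, charEuler_eq]

lemma diffOp_nonnegInd_mul {i m : Fin r} (h : i ≠ m) (h' : i ≠ m + 1) :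
    diffOp i (fun a => (nonnegInd (a m) * nonnegInd (a (m + 1)) : ℚ)) = 0 :=
  diffOp_eq_zero fun d d' hd => by rw [hd m h.symm, hd (m + 1) h'.symm]

omit [NeZero r] in
lemma diffOp_nonnegInd {i m : Fin r} (h : i ≠ m) :
    diffOp i (fun a => (nonnegInd (a m) : ℚ)) = 0 :=
  diffOp_eq_zero fun d d' hd => by rw [hd m h.symm]

/-- No summand of `charEulerQ` involves two nonadjacent coordinates. -/
lemma diffOp_diffOp_charEulerQ {j k : Fin r} (hjk : j ≠ k) (h1 : j ≠ k + 1) (h2 : k ≠ j + 1) :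
    diffOp j (diffOp k charEulerQ) = 0 := by
  rw [charEulerQ_eq]
  simp only [map_add, map_sub, map_sum]
  rw [diffOp_eq_zero (G := fun _ => (1 : ℚ)) (fun _ _ _ => rfl), map_zero, zero_sub,
    Finset.sum_eq_zero, Finset.sum_eq_zero, neg_zero, zero_add]
  · intro m _
    by_cases hk : k = m ∨ k = m + 1
    · have hj : j ≠ m ∧ j ≠ m + 1 := by
        rcases hk with rfl | rfl
        · exact ⟨hjk, h1⟩
        · exact ⟨fun h => h2 (by rw [h]), hjk⟩
      rw [diffOp_comm, diffOp_nonnegInd_mul hj.1 hj.2, map_zero]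
    · rw [not_or] at hk
      rw [diffOp_nonnegInd_mul hk.1 hk.2, map_zero]
  · intro m _
    by_cases hk : k = m
    · rw [diffOp_comm, diffOp_nonnegInd (hk ▸ hjk), map_zero]
    · rw [diffOp_nonnegInd hk, map_zero]

lemma neg_one_ne_zero (X : ToricFanoSurface r) : (-1 : Fin r) ≠ 0 := by
  have := X.sub_one_ne 0
  rwa [zero_sub] at this

/-- No summand involves three coordinates. This goes beyond the pair relations only for r = 3;
otherwise `j` is nonadjacent to 0 or to -1. -/
lemma diffOp_diffOp_diffOp_charEulerQ (X : ToricFanoSurface r) {j : Fin r} (h0 : j ≠ 0)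
    (h1 : j ≠ -1) : diffOp j (diffOp 0 (diffOp (-1) charEulerQ)) = 0 := by
  have hne := X.neg_one_ne_zero
  rw [charEulerQ_eq]
  simp only [map_add, map_sub, map_sum]
  rw [diffOp_eq_zero (G := fun _ => (1 : ℚ)) (fun _ _ _ => rfl), map_zero, map_zero, zero_sub,
    Finset.sum_eq_zero, Finset.sum_eq_zero, neg_zero, zero_add]
  · intro m _
    by_cases hk : -1 = m ∨ -1 = m + 1
    · by_cases hk' : 0 = m ∨ 0 = m + 1
      · have hj : j ≠ m ∧ j ≠ m + 1 := by
          rcases hk with rfl | hk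
          · exact ⟨h1, by simpa using h0⟩
          · rcases hk' with rfl | hk'
            · exact ⟨h0, fun h => h1 (h.trans hk.symm)⟩
            · exact absurd (hk.trans hk'.symm) hne
        rw [diffOp_comm j, diffOp_comm j, diffOp_nonnegInd_mul hj.1 hj.2, map_zero, map_zero]
      · rw [not_or] at hk'
        rw [diffOp_comm 0, diffOp_nonnegInd_mul hk'.1 hk'.2, map_zero, map_zero]
    · rw [not_or] at hk
      rw [diffOp_nonnegInd_mul hk.1 hk.2, map_zero, map_zero]
  · intro m _
    by_cases hk : -1 = m
    · rw [diffOp_comm 0, diffOp_nonnegInd (hk ▸ hne.symm), map_zero, map_zero]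
    · rw [diffOp_nonnegInd hk, map_zero, map_zero]

lemma orbitFinite_charEulerQ : X.OrbitFinite charEulerQ := by
  intro d
  refine (X.finite_charEuler d).subset fun u hu h => hu ?_
  simp only [charEulerQ]
  exact_mod_cast h

lemma orbitSum_charEulerQ (d : Divisor r) : X.orbitSum charEulerQ d = X.lineBundleEuler d := by
  have h : (Function.support fun u => charEuler (X.principal u + d)).Finite := X.finite_charEuler d
  exact ((Int.castAddHom ℚ).map_finsum h).symm

lemma orbitSum_mem_grothendieckDual : X.orbitSum charEulerQ ∈ X.grothendieckDual := by
  have hE := X.orbitFinite_charEulerQ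
  refine ⟨fun w => ?_, fun j k h1 h2 h3 => ?_, fun j h1 h2 => ?_⟩
  · funext d
    change X.orbitSum charEulerQ (X.principal w + d) = _
    rw [orbitSum_charEulerQ, orbitSum_charEulerQ, lineBundleEuler_principal_add]
  · rw [hE.diffOp_orbitSum, (hE.diffOp k).diffOp_orbitSum, diffOp_diffOp_charEulerQ h1 h2 h3,
      orbitSum_zero]
  · rw [hE.diffOp_orbitSum, (hE.diffOp _).diffOp_orbitSum,
      ((hE.diffOp _).diffOp _).diffOp_orbitSum, X.diffOp_diffOp_diffOp_charEulerQ h1 h2,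
      orbitSum_zero]

/-! ### Shelling of the fan and the bound on the length -/

/-- The restriction of characters to the stabilizer datum of the `k`-th maximal cone. -/
def coneMap (k : Fin r) : (ℤ × ℤ) →ₗ[ℤ] (ℤ × ℤ) where
  toFun w := (latticePairing w (X.v k), latticePairing w (X.v (k + 1)))
  map_add' w w' := by
    simp only [latticePairing, Prod.fst_add, Prod.snd_add, Prod.mk_add_mk, Prod.mk.injEq]
    constructor <;> ring
  map_smul' c w := by
    simp only [latticePairing, Prod.smul_fst, Prod.smul_snd, smul_eq_mul, Prod.smul_mk,
      RingHom.id_apply, Prod.mk.injEq]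
    constructor <;> ring

lemma det_coneMap (k : Fin r) :
    LinearMap.det (X.coneMap k) = latticeDet (X.v k) (X.v (k + 1)) := by
  rw [← LinearMap.det_toMatrix (Module.Basis.finTwoProd ℤ), Matrix.det_fin_two]
  simp [LinearMap.toMatrix_apply, coneMap, latticeDet, latticePairing]

lemma card_quotient_coneMap (k : Fin r) :
    (Nat.card ((ℤ × ℤ) ⧸ LinearMap.range (X.coneMap k)) : ℤ) =
      latticeDet (X.v k) (X.v (k + 1)) := by
  have hpos := X.origin_interior k
  have hinj : Function.Injective (X.coneMap k) := by
    rw [← LinearMap.ker_eq_bot]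
    by_contra h
    exact hpos.ne' (X.det_coneMap k ▸ LinearMap.det_eq_zero_iff_ker_ne_bot.2 h)
  have h := Submodule.natAbs_det_equiv (LinearMap.range (X.coneMap k))
    (LinearEquiv.ofInjective (X.coneMap k) hinj)
  rw [← h, Int.natCast_natAbs, ← abs_of_pos hpos, ← X.det_coneMap k]
  rfl

instance (k : Fin r) : Finite ((ℤ × ℤ) ⧸ LinearMap.range (X.coneMap k)) := by
  refine Nat.finite_of_card_ne_zero fun h => ?_
  have := X.card_quotient_coneMap k
  rw [h] at this
  exact (X.origin_interior k).ne' this.symm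

/-- The divisor with multiplicities `x` along the rays of the `k`-th maximal cone. -/
def coneDivisor (k : Fin r) (x : ℤ × ℤ) : Divisor r :=
  fun i => if i = k then x.1 else if i = k + 1 then x.2 else 0

-- `H` depends only on the two coordinates of the cone, and only modulo restrictions of characters,
-- so it is a function on a finite group and is tested on representatives.
variable {X} in
lemma eq_zero_of_cone (k : Fin r) {H : Divisor r → ℚ}
    (hinv : ∀ w, transOp (X.principal w) H = H) (hdiff : ∀ j, j ≠ k → j ≠ k + 1 → diffOp j H = 0)
    (hval : ∀ q : (ℤ × ℤ) ⧸ LinearMap.range (X.coneMap k), H (coneDivisor k q.out) = 0) : H = 0 := by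
  funext d
  let q : (ℤ × ℤ) ⧸ LinearMap.range (X.coneMap k) := Submodule.Quotient.mk (d k, d (k + 1))
  have hq : Submodule.Quotient.mk q.out = Submodule.Quotient.mk (d k, d (k + 1)) :=
    Quotient.out_eq q
  obtain ⟨w, hw⟩ := (Submodule.Quotient.eq _).1 hq
  have h1 : H (X.principal w + d) = H d := congrFun (hinv w) d
  refine (h1.symm.trans ?_).trans (hval q)
  refine eq_of_step_invariant H {j | j ≠ k ∧ j ≠ k + 1} (fun j hj d => ?_) fun i hi => ?_
  · exact sub_eq_zero.1 (congrFun (hdiff j hj.1 hj.2) d)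
  · obtain ⟨h2, h3⟩ := Prod.ext_iff.1 hw
    change latticePairing w (X.v k) = q.out.1 - d k at h2
    change latticePairing w (X.v (k + 1)) = q.out.2 - d (k + 1) at h3
    by_cases hk : i = k
    · subst hk
      simp [coneDivisor, principal, h2]
    · have hk' : i = k + 1 := by
        by_contra hk'
        exact hi ⟨hk, hk'⟩
      subst hk'
      simp [coneDivisor, principal, h3, hk]

/-- The operators attached to the maximal cones by the shelling of the fan in cyclic order. -/
def shellOp (k : Fin r) : (Divisor r → ℚ) →ₗ[ℚ] (Divisor r → ℚ) :=
  if k = 0 then LinearMap.id else if k = -1 then diffOp 0 ∘ₗ diffOp (-1) else diffOp (k + 1)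

lemma val_add_one_of_ne {k : Fin r} (hk : k ≠ -1) : (k + 1).val = k.val + 1 := by
  have h := val_sub_one (k + 1)
  rw [add_sub_cancel_right] at h
  have h0 : (k + 1).val ≠ 0 := fun h0 => hk (eq_neg_of_add_eq_zero_left (Fin.ext h0))
  rw [if_neg h0] at h
  rw [h, Nat.sub_add_cancel (Nat.pos_of_ne_zero h0)]

-- Add the cones in the order 0, …, r - 1; `shellOp k` is the product of the differences along the
-- rays of the minimal new face of cone `k`. By descending induction on `k`, the function `shellOp k
-- G` is killed by every difference along a ray outside the cone, so `eq_zero_of_cone` applies. Cone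
-- 0 gives `G` itself.
variable {X} in
lemma eq_zero_of_shellOp {G : Divisor r → ℚ} (hG : G ∈ X.grothendieckDual)
    (hval : ∀ (k : Fin r) (q : (ℤ × ℤ) ⧸ LinearMap.range (X.coneMap k)),
      shellOp k G (coneDivisor k q.out) = 0) : G = 0 := by
  obtain ⟨hinv, hSR, hSR'⟩ := hG
  have hm : (-1 : Fin r).val = r - 1 := by simpa using val_sub_one (0 : Fin r)
  have hne := X.neg_one_ne_zero
  have key : ∀ (m : ℕ) (k : Fin r), r ≤ k.val + m → shellOp k G = 0 := by
    intro m
    induction m with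
    | zero => exact fun k hk => absurd k.2 (by omega)
    | succ m ih =>
      intro k hk
      refine eq_zero_of_cone k (fun w => ?_) (fun j hj hj' => ?_) (hval k)
      · simp only [shellOp]
        split_ifs
        · exact hinv w
        · rw [LinearMap.comp_apply, ← diffOp_transOp, ← diffOp_transOp, hinv]
        · rw [← diffOp_transOp, hinv]
      · by_cases hk0 : k = 0
        · subst hk0
          rw [zero_add] at hj'
          have h0 : j - 1 ≠ 0 := fun h => hj' (sub_eq_zero.1 h)
          have h1 : j - 1 ≠ -1 := fun h => hj (by simpa using h)
          have h2 := ih (j - 1) (by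
            have : (j - 1).val ≠ 0 := fun h => h0 (Fin.ext h)
            have : (0 : Fin r).val = 0 := Fin.val_zero r
            omega)
          rw [shellOp, if_neg h0, if_neg h1, sub_add_cancel] at h2
          rw [shellOp, if_pos rfl]
          exact h2
        by_cases hk1 : k = -1
        · subst hk1
          rw [neg_add_cancel] at hj'
          rw [shellOp, if_neg hk0, if_pos rfl]
          exact hSR' j hj' hj
        rw [shellOp, if_neg hk0, if_neg hk1]
        have hlt := val_add_one_of_ne hk1
        -- The ray following the cone is not covered by a pair relation; its difference is supplied
        -- by the next cone of the shelling, which for j = 0 is the last one.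
        by_cases hjk : j = k + 1 + 1
        · by_cases hj0 : j = 0
          · have h1 : k + 1 = -1 := eq_neg_of_add_eq_zero_left (hjk.symm.trans hj0)
            have h2 := ih (k + 1) (by omega)
            rw [h1, shellOp, if_neg hne, if_pos rfl] at h2
            rw [hj0, h1]
            exact h2
          · have h2 := ih (k + 1) (by omega)
            rw [shellOp, if_neg, if_neg, ← hjk] at h2
            · rw [diffOp_comm, h2, map_zero]
            · exact fun h => hj0 (by rw [hjk, h, neg_add_cancel])
            · exact fun h => hk1 (eq_neg_of_add_eq_zero_left h)
        · exact hSR j (k + 1) hj' hjk fun h => hj (add_right_cancel h).symm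
  have := key r 0 (by omega)
  rwa [shellOp, if_pos rfl] at this

variable {X} in
/-- An exceptional collection of line bundles has at most `χ(X)` members. -/
theorem IsStrongExceptional.card_le_eulerChar {n : ℕ} {D : Fin n → Divisor r}
    (hD : X.IsStrongExceptional D) : (n : ℤ) ≤ X.eulerChar := by
  classical
  let F := X.orbitSum charEulerQ
  let T : (Fin n → ℚ) →ₗ[ℚ] (Divisor r → ℚ) :=
    Fintype.linearCombination ℚ fun j => transOp (-D j) F
  have hT : ∀ c, T c ∈ X.grothendieckDual := fun c => by
    rw [Fintype.linearCombination_apply]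
    exact Submodule.sum_mem _ fun j _ => Submodule.smul_mem _ _
      (transOp_mem_grothendieckDual X.orbitSum_mem_grothendieckDual _)
  let Q : Fin r → Type := fun k => (ℤ × ℤ) ⧸ LinearMap.range (X.coneMap k)
  have : ∀ k, Finite (Q k) := fun k =>
    inferInstanceAs (Finite ((ℤ × ℤ) ⧸ LinearMap.range (X.coneMap k)))
  have := fun k => Fintype.ofFinite (Q k)
  -- The target has dimension ∑ |Q k| = χ(X), so injectivity of `Φ` is the bound.
  let Φ : (Fin n → ℚ) →ₗ[ℚ] ((Σ k, Q k) → ℚ) := LinearMap.pi fun s =>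
    LinearMap.proj (coneDivisor s.1 (Quotient.out s.2)) ∘ₗ shellOp s.1 ∘ₗ T
  have hΦ : Function.Injective Φ := by
    rw [← LinearMap.ker_eq_bot, LinearMap.ker_eq_bot']
    intro c hc
    have h0 : T c = 0 := eq_zero_of_shellOp (hT c) fun k q => congrFun hc ⟨k, q⟩
    -- This is the Gram matrix of the Euler form, unitriangular by exceptionality and χ(𝒪) = 1.
    -- Evaluating `T c = 0` at the divisors `D i` gives A c = 0.
    let A : Matrix (Fin n) (Fin n) ℚ := fun i j => F (-D j + D i)
    have hA : A.det = 1 := by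
      rw [Matrix.det_of_isLowerTriangular]
      · refine Finset.prod_eq_one fun i _ => ?_
        simp only [A, F]
        rw [neg_add_cancel, orbitSum_charEulerQ, lineBundleEuler_zero, Int.cast_one]
      · intro i j hij
        have hz : X.lineBundleEuler (D i - D j) = 0 :=
          lineBundleEuler_eq_zero (hD.exceptional j i hij)
        simp only [A, F]
        rw [neg_add_eq_sub, orbitSum_charEulerQ, hz, Int.cast_zero]
    refine Matrix.eq_zero_of_mulVec_eq_zero (by rw [hA]; exact one_ne_zero) (M := A) ?_
    funext i
    refine Eq.trans ?_ (congrFun h0 (D i))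
    rw [Fintype.linearCombination_apply, Finset.sum_apply]
    change ∑ j, F (-D j + D i) * c j = _
    exact Finset.sum_congr rfl fun j _ => mul_comm (F (-D j + D i)) (c j)
  have h := LinearMap.finrank_le_finrank_of_injective hΦ
  rw [Module.finrank_fintype_fun_eq_card, Module.finrank_fintype_fun_eq_card, Fintype.card_fin,
    Fintype.card_sigma] at h
  refine (Int.ofNat_le.2 h).trans_eq ?_
  rw [eulerChar]
  push_cast
  refine Finset.sum_congr rfl fun k _ => ?_
  rw [← X.card_quotient_coneMap k, Nat.card_eq_fintype_card]

/-- Each of the at least three cones contributes at least 1. This supplies the condition k ≥ 3 of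
the degree count. -/
lemma three_le_eulerChar : 3 ≤ X.eulerChar := by
  have h1 : ∑ _i : Fin r, (1 : ℤ) ≤ X.eulerChar :=
    Finset.sum_le_sum fun i _ => X.origin_interior i
  have h2 := X.three_le
  simp only [Finset.sum_const, Finset.card_univ, Fintype.card_fin, nsmul_eq_mul, mul_one] at h1
  omega

end ToricFanoSurface

/-! ### Passage to the brackets and to the cyclic completion -/

section Graded

variable {ι : Type} [Fintype ι] [DecidableEq ι] {W : ℤ → ι → ι → Type}
  [∀ d i j, AddCommGroup (W d i j)] [∀ d i j, Module ℂ (W d i j)]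

lemma antisymmetrization_zero (k : ℕ) : antisymmetrization
    (0 : MultilinearMap ℂ (fun _ : Fin k => TotalSpace W) (TotalSpace W)) = 0 := by
  ext x
  simp [antisymmetrization]

lemma cyclicCompletion_eq_zero (ε : RotationSign)
    (μ : ∀ k, MultilinearMap ℂ (fun _ : Fin k => TotalSpace W) (TotalSpace W)) {k : ℕ}
    (h : μ k = 0) (a : Fin k → TotalSpace W × Module.Dual ℂ (TotalSpace W)) :
    cyclicCompletion ε μ k a = 0 := by
  have h0 : ∀ (x : Fin k → TotalSpace W) (i : Fin k), (μ k).toLinearMap x i = 0 := by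
    intro x i
    ext y
    simp [h]
  simp only [cyclicCompletion, h0, LinearMap.zero_comp, LinearMap.comp_zero, smul_zero,
    Finset.sum_const_zero]
  rw [h]
  rfl

end Graded

end

theorem mainTheorem4 {r : ℕ} [NeZero r] (X : ToricFanoSurface r) {n : ℕ}
    (D : Fin n → ToricFanoSurface.Divisor r) (hD : X.IsStrongExceptional D)
    (P : ∀ i, CategoryTheory.ProjectiveResolution (hD.simpleModule i))
    (R : YonedaAInfinity fun i => (P i).cochainComplex) :
    (∀ k : ℕ, X.eulerChar < k → R.bracket k = 0) ∧
      ∀ (ε : RotationSign) (k : ℕ), X.eulerChar < k →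
        ∀ a, cyclicCompletion ε R.bracket k a = 0 := by
  have hR : ∀ k : ℕ, X.eulerChar < k → R.bracket k = 0 := by
    intro k hk
    have h1 := hD.card_le_eulerChar
    have h2 := X.three_le_eulerChar
    exact (congrArg antisymmetrization (R.m_eq_zero hD P (by omega) (by omega))).trans
      (antisymmetrization_zero k)
  exact ⟨hR, fun ε k hk a => cyclicCompletion_eq_zero ε R.bracket (hR k hk) a⟩
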